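/- Let $G$ be a compact Lie group with normalized Haar measure $dy$, $K\subset G$ a closed subgroup, and $(\tau_E,E_0)$, $(\tau_F,F_0)$ irreducible unitary representations of $K$ on finite-dimensional Hilbert spaces. Let $E=G\times_{\tau_E}E_0$ and $F=G\times_{\tau_F}F_0$ be the associated homogeneous vector bundles over $G/K$, and identify $$\Gamma(E)=\{u\in C^\infty(G,E_0): u(gh)=\tau_E(h)^{-1}u(g)\ \text{for all } g\in G,\ h\in K\},$$ and similarly $\Gamma(F)$. Let $A:\Gamma(E)\to\Gamma(F)$ be a homogeneous operator, i.e. a linear map, continuous for the $C^\infty$ topologies, that commutes with the $G$-action $(g\cdot u)(x)=u(g^{-1}x)$. Then $A$ has a unique Schwartz kernel: a family of distributions $K_A(x,\cdot)\in\mathcal D'(G,\operatorname{Hom}(E_0,F_0))$, $x\in G$, such that, in the sense of distributions in $y$, $$Au(x)=\int_G K_A(x,y)\,u(y)\,dy\quad\text{for } u\in\Gamma(E),\ x\in G,\qquad K_A(x,yh)=K_A(x,y)\,\tau_E(h)\quad\text{for } h\in K.$$ Put $r_x(z)=K_A(x,xz^{-1})$, the kernel in convolution form. For an irreducible unitary representation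 $\lambda:G\to U(\mathcal H_\lambda)$ (all of whose matrix coefficients are smooth), define the symbol of $A$ as the Fourier transform of $r_x$, $$\sigma_A(\lambda,x)=\int_G\lambda(z)^*\,r_x(z)\,dz=\int_G \lambda(y^{-1}x)^*\,K_A(x,y)\,dy\ \in\ \operatorname{End}(\mathcal H_\lambda)\otimes\operatorname{Hom}(E_0,F_0)$$ in the sense of distributions, and let $\widehat u(\lambda)=\int_G\lambda(y)^*\,u(y)\,dy\in\operatorname{End}(\mathcal H_\lambda)\otimes E_0$. Then for every $u\in\Gamma(E)$ and every $x\in G$, $$Au(x)=\sum_{\lambda\in\widehat G}\dim\lambda\cdot\operatorname{Tr}\bigl(\lambda(x)\,\sigma_A(\lambda,x)\,\widehat u(\lambda)\bigr),$$ where the series converges unconditionally in $F_0$, $\widehat G$ is the set of equivalence classes of irreducible unitary representations of $G$ (with any choice of representatives), the product composes the $\operatorname{End}(\mathcal H_\lambda)$ factors and evaluates $\operatorname{Hom}(E_0,F_0)$ on $E_0$, and $\operatorname{Tr}$ is the trace over $\operatorname{End}(\mathcal H_\lambda)$. -/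

import Mathlib

open scoped Manifold ContDiff Matrix InnerProductSpace Topology
open MeasureTheory

noncomputable section

namespace HomogeneousBundle

/-! ### Unitary representations and the unitary dual -/

/-- `ρ` is a strongly continuous, irreducible, unitary representation of the topological group `Γ`
on the complex inner product space `V`. (Irreducible representations are nonzero.) -/
structure IsIrreducibleUnitary {Γ V : Type*} [Group Γ] [TopologicalSpace Γ]
    [NormedAddCommGroup V] [InnerProductSpace ℂ V] (ρ : Representation ℂ Γ V) : Prop where
  continuous : ∀ v, Continuous fun g => ρ g v
  unitary : ∀ g v w, ⟪ρ g v, ρ g w⟫_ℂ = ⟪v, w⟫_ℂ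
  irreducible : ρ.IsIrreducible

/-- An irreducible unitary representation of `G` on a space `ℂ ^ dim` with its standard inner
product. Since irreducible unitary representations of compact groups are finite-dimensional, every
one of them is unitarily equivalent to one of this form. -/
structure UnitaryIrrep (G : Type*) [Group G] [TopologicalSpace G] where
  dim : ℕ
  rep : Representation ℂ G (EuclideanSpace ℂ (Fin dim))
  isIrreducibleUnitary : IsIrreducibleUnitary rep

/-- Equivalence of representations. -/
instance UnitaryIrrep.setoid (G : Type*) [Group G] [TopologicalSpace G] :
    Setoid (UnitaryIrrep G) where
  r π π' := Nonempty (π.rep.Equiv π'.rep)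
  iseqv :=
    { refl := fun π => ⟨Representation.Equiv.refl π.rep⟩
      symm := fun ⟨e⟩ => ⟨e.symm⟩
      trans := fun ⟨e⟩ ⟨f⟩ => ⟨e.trans f⟩ }

/-- The unitary dual of `G`: equivalence classes of irreducible unitary representations. -/
def UnitaryDual (G : Type*) [Group G] [TopologicalSpace G] : Type _ :=
  Quotient (UnitaryIrrep.setoid G)

/-- The class of an irreducible unitary representation in the unitary dual. -/
def UnitaryIrrep.toDual {G : Type*} [Group G] [TopologicalSpace G] (π : UnitaryIrrep G) :
    UnitaryDual G :=
  Quotient.mk (UnitaryIrrep.setoid G) π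

/-- The unitary matrix `λ(g)` in the standard basis. -/
def UnitaryIrrep.matrix {G : Type*} [Group G] [TopologicalSpace G] (π : UnitaryIrrep G) (g : G) :
    Matrix (Fin π.dim) (Fin π.dim) ℂ :=
  Matrix.of fun i j => π.rep g (EuclideanSpace.single j 1) i

/-! ### Smooth functions on `G` and sections of homogeneous bundles -/

section Smooth

variable (n : ℕ) {G : Type*} [Group G] [TopologicalSpace G]
  [ChartedSpace (EuclideanSpace ℝ (Fin n)) G]
  {V : Type*} [NormedAddCommGroup V] [NormedSpace ℂ V]

/-- The derivative of `u : G → V` along the left-invariant vector field with value `X` at `1`. -/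
def leftInvDeriv (X : GroupLieAlgebra (𝓡 n) G) (u : G → V) : G → V :=
  fun g => mfderiv (𝓡 n) 𝓘(ℝ, V) u g (mulInvariantVectorField X g)

/-- Iterated derivative `X₁ X₂ ⋯ X_r u` along left-invariant vector fields. -/
def iterLeftInvDeriv : List (GroupLieAlgebra (𝓡 n) G) → (G → V) → (G → V)
  | [], u => u
  | X :: L, u => leftInvDeriv n X (iterLeftInvDeriv L u)

variable (G V) in
/-- The space `C^∞(G, V)`. -/
def smoothFunctions : Submodule ℂ (G → V) where
  carrier := {u | ContMDiff (𝓡 n) 𝓘(ℝ, V) ∞ u}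
  add_mem' hu hv := ContMDiff.add hu hv
  zero_mem' := contMDiff_const
  smul_mem' c u hu := by
    have h : ContMDiff 𝓘(ℝ, V) 𝓘(ℝ, V) ∞ (fun v : V => c • v) :=
      (contDiff_const_smul c).contMDiff
    exact h.comp hu

/-- The `C^∞` topology on a space of smooth functions on `G`: uniform convergence on `G` of
all iterated derivatives along left-invariant vector fields. -/
abbrev smoothTopology (S : Submodule ℂ (G → V)) : TopologicalSpace S :=
  ⨅ L : List (GroupLieAlgebra (𝓡 n) G),
    TopologicalSpace.induced (fun u : S => UniformFun.ofFun (iterLeftInvDeriv n L (u : G → V)))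
      (UniformFun.topologicalSpace G V)

/-- The space `Γ(E)` of smooth sections of the homogeneous bundle `E = G ×_τ V` over `G / K`,
as the smooth functions `u : G → V` with `u (g k) = τ(k)⁻¹ u(g)`. -/
def smoothSections {K : Subgroup G} (τ : Representation ℂ K V) : Submodule ℂ (G → V) where
  carrier := {u | u ∈ smoothFunctions n G V ∧ ∀ (g : G) (k : K), u (g * k) = τ k⁻¹ (u g)}
  add_mem' hu hv := ⟨add_mem hu.1 hv.1, fun g k => by simp [hu.2 g k, hv.2 g k]⟩
  zero_mem' := ⟨zero_mem _, fun g k => by simp⟩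
  smul_mem' c u hu := ⟨Submodule.smul_mem _ c hu.1, fun g k => by simp [hu.2 g k]⟩

variable {n}

/-- A section of `E`, regarded as a smooth `V`-valued function on `G`. -/
def toSmooth {K : Subgroup G} {τ : Representation ℂ K V}
    (u : smoothSections n τ) : smoothFunctions n G V :=
  ⟨u, u.2.1⟩

variable [LieGroup (𝓡 n) ∞ G]

/-- The action of `g` on sections: `(g · u)(x) = u (g⁻¹ x)`. -/
def leftTranslate {K : Subgroup G} {τ : Representation ℂ K V} (g : G) (u : smoothSections n τ) :
    smoothSections n τ :=
  ⟨fun x => (u : G → V) (g⁻¹ * x),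
    ContMDiff.comp u.2.1 (contMDiff_mul_left (I := 𝓡 n) (n := ∞) (a := g⁻¹)),
    fun x k => by
      simpa [mul_assoc] using u.2.2 (g⁻¹ * x) k⟩

/-- A homogeneous operator `A : Γ(E) → Γ(F)`: a linear map that is continuous for the `C^∞`
topologies and commutes with the action of `G`. -/
structure IsHomogeneousOperator {V' : Type*} [NormedAddCommGroup V'] [NormedSpace ℂ V']
    {K : Subgroup G} {τE : Representation ℂ K V} {τF : Representation ℂ K V'}
    (A : smoothSections n τE →ₗ[ℂ] smoothSections n τF) : Prop where
  continuous : Continuous[smoothTopology n (smoothSections n τE),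
    smoothTopology n (smoothSections n τF)] A
  invariant : ∀ (g : G) (u : smoothSections n τE), A (leftTranslate g u) = leftTranslate g (A u)

/-! ### Distributions on `G` -/

/-- The right translate `y ↦ φ (y h)` of a test function. -/
def rightTranslate (h : G) (φ : smoothFunctions n G V) : smoothFunctions n G V :=
  ⟨fun y => (φ : G → V) (y * h),
    ContMDiff.comp φ.2 (contMDiff_mul_right (I := 𝓡 n) (n := ∞) (a := h))⟩

/-- The substitution `ψ ↦ (y ↦ ψ (y⁻¹ x))`. -/
def invSubst (x : G) (ψ : smoothFunctions n G V) : smoothFunctions n G V :=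
  ⟨fun y => (ψ : G → V) (y⁻¹ * x),
    ContMDiff.comp ψ.2 ((contMDiff_mul_right (I := 𝓡 n) (n := ∞) (a := x)).comp
      (contMDiff_inv (𝓡 n) ∞))⟩

end Smooth

/-- The space `𝒟'(G, Hom(E₀, F₀))` of `Hom(E₀, F₀)`-valued distributions on the compact group `G`:
continuous linear maps `C^∞(G) → Hom(E₀, F₀)`. -/
@[ext]
structure HomDistribution (n : ℕ) (G : Type*) [Group G] [TopologicalSpace G]
    [ChartedSpace (EuclideanSpace ℝ (Fin n)) G] (E₀ F₀ : Type*)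
    [NormedAddCommGroup E₀] [InnerProductSpace ℂ E₀]
    [NormedAddCommGroup F₀] [InnerProductSpace ℂ F₀] where
  toLinearMap : smoothFunctions n G ℂ →ₗ[ℂ] (E₀ →L[ℂ] F₀)
  continuous : Continuous[smoothTopology n (smoothFunctions n G ℂ), inferInstance] toLinearMap

section Kernel

variable {n : ℕ} {G : Type*} [Group G] [TopologicalSpace G]
  [ChartedSpace (EuclideanSpace ℝ (Fin n)) G]
  {E₀ : Type*} [NormedAddCommGroup E₀] [InnerProductSpace ℂ E₀]
  {F₀ : Type*} [NormedAddCommGroup F₀] [InnerProductSpace ℂ F₀]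

/-- The component `y ↦ ⟨v, u(y)⟩` of a smooth `E₀`-valued function. -/
def component (v : E₀) (u : smoothFunctions n G E₀) : smoothFunctions n G ℂ :=
  ⟨fun y => ⟪v, (u : G → E₀) y⟫_ℂ, by
    have h : ContMDiff 𝓘(ℝ, E₀) 𝓘(ℝ, ℂ) ∞ (fun w : E₀ => ⟪v, w⟫_ℂ) :=
      (((innerSL ℂ v).restrictScalars ℝ).contDiff).contMDiff
    exact h.comp u.2⟩

/-- The pairing `∫_G T(y) u(y) dy` of a `Hom(E₀, F₀)`-valued distribution with a smooth
`E₀`-valued function, computed in an orthonormal basis of `E₀`. -/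
def HomDistribution.pair [FiniteDimensional ℂ E₀] (T : HomDistribution n G E₀ F₀)
    (u : smoothFunctions n G E₀) : F₀ :=
  ∑ a, T.toLinearMap (component (stdOrthonormalBasis ℂ E₀ a) u) (stdOrthonormalBasis ℂ E₀ a)

variable [LieGroup (𝓡 n) ∞ G]

/-- `k` is the Schwartz kernel of `A : Γ(E) → Γ(F)`. Here `k x` is the distribution `K_A(x, ·)`;
the conditions say that `A u(x) = ∫_G K_A(x, y) u(y) dy` and that
`K_A(x, y h) = K_A(x, y) τE(h)` for `h ∈ K`, both in the sense of distributions in `y`. -/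
structure IsSchwartzKernel [FiniteDimensional ℂ E₀] {K : Subgroup G}
    {τE : Representation ℂ K E₀} {τF : Representation ℂ K F₀}
    (A : smoothSections n τE →ₗ[ℂ] smoothSections n τF)
    (k : G → HomDistribution n G E₀ F₀) : Prop where
  represents : ∀ (u : smoothSections n τE) (x : G),
    (A u : G → F₀) x = (k x).pair (toSmooth u)
  equivariant : ∀ (x : G) (h : K) (φ : smoothFunctions n G ℂ) (v : E₀),
    (k x).toLinearMap (rightTranslate (h : G)⁻¹ φ) v = (k x).toLinearMap φ (τE h v)

/-- The kernel in convolution form, `r_x(z) = K_A(x, x z⁻¹)`, as a functional of a test function: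
`∫_G r_x(z) ψ(z) dz = ∫_G K_A(x, y) ψ(y⁻¹ x) dy`. -/
def convKernel (k : G → HomDistribution n G E₀ F₀) (x : G) (ψ : smoothFunctions n G ℂ) :
    E₀ →L[ℂ] F₀ :=
  (k x).toLinearMap (invSubst x ψ)

end Kernel

/-! ### Fourier coefficients and the symbol

Elements of `End(ℂ ^ d) ⊗ W` are written as `d × d` matrices with entries in `W`. -/

/-- The functions `z ↦ (λ(z)^*)_{ij}` are smooth on `G`. -/
def UnitaryIrrep.IsSmooth (n : ℕ) {G : Type*} [Group G] [TopologicalSpace G]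
    [ChartedSpace (EuclideanSpace ℝ (Fin n)) G] (π : UnitaryIrrep G) : Prop :=
  ∀ i j, (fun z => (π.matrix z)ᴴ i j) ∈ smoothFunctions n G ℂ

/-- The symbol `σ_A(λ, x) = ∫_G λ(z)^* r_x(z) dz`, the Fourier transform at `λ` of the kernel
`r_x`, an element of `End(H_λ) ⊗ Hom(E₀, F₀)`. -/
def symbol {n : ℕ} {G : Type*} [Group G] [TopologicalSpace G]
    [ChartedSpace (EuclideanSpace ℝ (Fin n)) G] [LieGroup (𝓡 n) ∞ G]
    {E₀ : Type*} [NormedAddCommGroup E₀] [InnerProductSpace ℂ E₀]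
    {F₀ : Type*} [NormedAddCommGroup F₀] [InnerProductSpace ℂ F₀]
    (k : G → HomDistribution n G E₀ F₀) (π : UnitaryIrrep G) (hπ : π.IsSmooth n) (x : G) :
    Matrix (Fin π.dim) (Fin π.dim) (E₀ →L[ℂ] F₀) :=
  Matrix.of fun i j => convKernel k x ⟨fun z => (π.matrix z)ᴴ i j, hπ i j⟩

/-- The Fourier coefficient `û(λ) = ∫_G λ(y)^* u(y) dy`, an element of `End(H_λ) ⊗ E₀`. -/
def fourierCoeff {G : Type*} [Group G] [TopologicalSpace G] [MeasurableSpace G] (μ : Measure G)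
    {E₀ : Type*} [NormedAddCommGroup E₀] [NormedSpace ℂ E₀] (u : G → E₀) (π : UnitaryIrrep G) :
    Matrix (Fin π.dim) (Fin π.dim) E₀ :=
  Matrix.of fun i j => ∫ y, (π.matrix y)ᴴ i j • u y ∂μ

/-- The product of `σ ∈ End(ℂ ^ d) ⊗ Hom(E₀, F₀)` with `m ∈ End(ℂ ^ d) ⊗ E₀`: composition in
`End(ℂ ^ d)`, evaluation in `Hom(E₀, F₀) × E₀`. -/
def applySymbol {d : ℕ} {E₀ F₀ : Type*} [NormedAddCommGroup E₀] [NormedSpace ℂ E₀]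
    [NormedAddCommGroup F₀] [NormedSpace ℂ F₀]
    (σ : Matrix (Fin d) (Fin d) (E₀ →L[ℂ] F₀)) (m : Matrix (Fin d) (Fin d) E₀) :
    Matrix (Fin d) (Fin d) F₀ :=
  Matrix.of fun i j => ∑ l, σ i l (m l j)

/-- The product of a scalar matrix with an element of `End(ℂ ^ d) ⊗ W`. -/
def scalarMul {d : ℕ} {W : Type*} [AddCommGroup W] [Module ℂ W]
    (a : Matrix (Fin d) (Fin d) ℂ) (m : Matrix (Fin d) (Fin d) W) : Matrix (Fin d) (Fin d) W :=
  Matrix.of fun i j => ∑ l, a i l • m l j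

end HomogeneousBundle

end

namespace HomogeneousBundle

open Filter

section Curry

variable {E : Type} [NormedAddCommGroup E] [NormedSpace ℝ E]
  {EZ HZ Z : Type*} [NormedAddCommGroup EZ] [NormedSpace ℝ EZ] [TopologicalSpace HZ]
  {I : ModelWithCorners ℝ EZ HZ} [TopologicalSpace Z] [ChartedSpace HZ Z]

/-- The partial derivative in the vector variable of a jointly smooth function is jointly smooth. -/
theorem contMDiffOn_partial_fderiv [IsManifold I ∞ Z]
    {V : Type*} [NormedAddCommGroup V] [NormedSpace ℝ V]
    {U : Set E} (hU : IsOpen U) {f : E × Z → V}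
    (hf : ContMDiffOn (𝓘(ℝ, E).prod I) 𝓘(ℝ, V) ∞ f (U ×ˢ Set.univ)) :
    ContMDiffOn (𝓘(ℝ, E).prod I) 𝓘(ℝ, E →L[ℝ] V) ∞
      (fun p => fderiv ℝ (fun x => f (x, p.2)) p.1) (U ×ˢ Set.univ) := by
  intro p hp
  have hopen : IsOpen (U ×ˢ (Set.univ : Set Z)) := hU.prod isOpen_univ
  have h1 : ContMDiffAt (𝓘(ℝ, E).prod I) 𝓘(ℝ, V) ∞ f (p.1, p.2) :=
    hf.contMDiffAt (hopen.mem_nhds hp)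
  have h2 : ContMDiffAt ((𝓘(ℝ, E).prod I).prod 𝓘(ℝ, E)) 𝓘(ℝ, V) ∞
      (Function.uncurry fun (q : E × Z) (x : E) => f (x, q.2)) (p, p.1) := by
    refine ContMDiffAt.comp (I' := 𝓘(ℝ, E).prod I) (p, p.1)
      (g := f) (f := fun q : (E × Z) × E => (q.2, q.1.2)) h1 ?_
    exact contMDiffAt_snd.prodMk (contMDiffAt_snd.comp _ contMDiffAt_fst)
  have h3 := ContMDiffAt.mfderiv (m := ∞) (fun (q : E × Z) (x : E) => f (x, q.2)) Prod.fst h2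
    contMDiffAt_fst (by simp)
  have h4 := inTangentCoordinates_model_space (I := 𝓘(ℝ, E)) (I' := 𝓘(ℝ, V))
    (Prod.fst : E × Z → E) (fun p : E × Z => f (p.1, p.2))
    (fun p : E × Z => fderiv ℝ (fun x => f (x, p.2)) p.1) p
  simp only [mfderiv_eq_fderiv] at h3
  exact (h3.congr_of_eventuallyEq (Filter.EventuallyEq.of_eq h4.symm)).contMDiffWithinAt

variable {V : Type*} [NormedAddCommGroup V] [NormedSpace ℝ V]

variable (E Z V) in
/-- A continuous family of linear maps, as a linear map into continuous functions. -/
noncomputable def swapCLM [CompactSpace Z] : C(Z, E →L[ℝ] V) →L[ℝ] E →L[ℝ] C(Z, V) :=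
  LinearMap.mkContinuous₂
    (LinearMap.mk₂ ℝ (fun (F : C(Z, E →L[ℝ] V)) (e : E) =>
        (⟨fun z => F z e, F.continuous.clm_apply continuous_const⟩ : C(Z, V)))
      (fun _ _ _ => by ext; simp) (fun _ _ _ => by ext; simp)
      (fun _ _ _ => by ext; simp) (fun _ _ _ => by ext; simp)) 1 (by
    intro F e
    rw [one_mul]
    refine (ContinuousMap.norm_le _ (by positivity)).2 fun z => ?_
    exact ((F z).le_opNorm e).trans (by gcongr; exact F.norm_coe_le_norm z))

@[simp]
theorem swapCLM_apply [CompactSpace Z] (F : C(Z, E →L[ℝ] V)) (e : E) (z : Z) :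
    swapCLM E Z V F e z = F z e := rfl

theorem continuousOn_of_uncurry {X Y : Type*} [TopologicalSpace X] [TopologicalSpace Y]
    {U : Set X} {f : X × Z → Y} (hf : ContinuousOn f (U ×ˢ Set.univ))
    {F : X → C(Z, Y)} (hF : ∀ x ∈ U, ∀ z, F x z = f (x, z)) : ContinuousOn F U := by
  rw [continuousOn_iff_continuous_domRestrict]
  refine ContinuousMap.continuous_of_continuous_uncurry _ ?_
  have : Function.uncurry (fun (x : U) z => F x z) = fun p : U × Z => f (p.1, p.2) := by
    ext p; exact hF p.1 p.1.2 p.2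
  change Continuous (Function.uncurry (fun (x : U) z => F x z))
  rw [this]
  exact hf.comp_continuous (by fun_prop) (fun p => ⟨p.1.2, trivial⟩)

theorem hasFDerivAt_of_uncurry [CompactSpace Z] {U : Set E} (hU : IsOpen U) {f : E × Z → V}
    (hf : ∀ x ∈ U, ∀ z, DifferentiableAt ℝ (fun x => f (x, z)) x)
    {F : E → C(Z, V)} (hF : ∀ x ∈ U, ∀ z, F x z = f (x, z))
    {F' : E → C(Z, E →L[ℝ] V)} (hFc : ContinuousOn F' U)
    (hF' : ∀ x ∈ U, ∀ z, F' x z = fderiv ℝ (fun x => f (x, z)) x) {x : E} (hx : x ∈ U) :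
    HasFDerivAt F (swapCLM E Z V (F' x)) x := by
  rw [hasFDerivAt_iff_isLittleO, Asymptotics.isLittleO_iff]
  intro c hc
  have hcont : ContinuousAt F' x := hFc.continuousAt (hU.mem_nhds hx)
  obtain ⟨r, hr, hball⟩ := Metric.eventually_nhds_iff_ball.1
    ((hcont.eventually (Metric.ball_mem_nhds (F' x) hc)).and (hU.mem_nhds hx))
  filter_upwards [Metric.ball_mem_nhds x hr] with y hy
  refine (ContinuousMap.norm_le _ (by positivity)).2 fun z => ?_
  have hb := (convex_ball x r).norm_image_sub_le_of_norm_fderiv_le' (𝕜 := ℝ)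
    (f := fun x => f (x, z)) (C := c) (φ := F' x z) (x := x) (y := y)
    (fun y hy => hf y (hball y hy).2 z) (fun y hy => ?_) (Metric.mem_ball_self hr) hy
  · simpa [hF y (hball y hy).2, hF x hx] using hb
  · rw [← hF' y (hball y hy).2]
    have : ‖F' y - F' x‖ < c := (dist_eq_norm (F' y) (F' x)).symm.trans_lt (hball y hy).1
    exact ((F' y - F' x).norm_coe_le_norm z).trans this.le

/-- A jointly smooth function on `U × Z` with `Z` compact is a smooth function on `U` with values in
the continuous functions on `Z`. -/
theorem contDiffOn_of_uncurry.{u} [IsManifold I ∞ Z] [CompactSpace Z] {U : Set E} (hU : IsOpen U)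
    (m : ℕ) : ∀ {V : Type u} [NormedAddCommGroup V] [NormedSpace ℝ V] {f : E × Z → V}
    (_ : ContMDiffOn (𝓘(ℝ, E).prod I) 𝓘(ℝ, V) ∞ f (U ×ˢ Set.univ))
    {F : E → C(Z, V)} (_ : ∀ x ∈ U, ∀ z, F x z = f (x, z)), ContDiffOn ℝ m F U := by
  induction m with
  | zero =>
    intro V _ _ f hf F hF
    exact contDiffOn_zero.2 (continuousOn_of_uncurry hf.continuousOn hF)
  | succ m ih =>
    intro V _ _ f hf F hF
    have hopen : IsOpen (U ×ˢ (Set.univ : Set Z)) := hU.prod isOpen_univ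
    have hd := contMDiffOn_partial_fderiv hU hf
    classical
    let F' : E → C(Z, E →L[ℝ] V) := fun x =>
      if hx : x ∈ U then ⟨fun z => fderiv ℝ (fun x => f (x, z)) x,
        hd.continuousOn.comp_continuous (f := fun z => (x, z)) (by fun_prop)
          (fun z => ⟨hx, trivial⟩)⟩ else 0
    have hF' : ∀ x ∈ U, ∀ z, F' x z = fderiv ℝ (fun x => f (x, z)) x := by
      intro x hx z; simp [F', hx]
    have hdiff : ∀ x ∈ U, ∀ z, DifferentiableAt ℝ (fun x => f (x, z)) x := by
      intro x hx z
      have h1 : ContMDiffAt (𝓘(ℝ, E).prod I) 𝓘(ℝ, V) ∞ f (x, z) :=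
        hf.contMDiffAt (hopen.mem_nhds ⟨hx, trivial⟩)
      have h2 : ContMDiffAt 𝓘(ℝ, E) 𝓘(ℝ, V) ∞ (fun x => f (x, z)) x :=
        h1.comp x (contMDiffAt_id.prodMk contMDiffAt_const)
      exact h2.contDiffAt.differentiableAt (by simp)
    have key : ∀ x ∈ U, HasFDerivAt F (swapCLM E Z V (F' x)) x := fun x hx =>
      hasFDerivAt_of_uncurry hU hdiff hF (continuousOn_of_uncurry hd.continuousOn hF') hF' hx
    push_cast
    rw [contDiffOn_succ_iff_hasFDerivWithinAt_of_uniqueDiffOn hU.uniqueDiffOn]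
    refine ⟨by simp, fun x => swapCLM E Z V (F' x), ?_, fun x hx => (key x hx).hasFDerivWithinAt⟩
    exact (swapCLM E Z V).contDiff.comp_contDiffOn (ih hd hF')

end Curry

section CurryManifold

variable {EN : Type} {HN N : Type*} [NormedAddCommGroup EN] [NormedSpace ℝ EN] [TopologicalSpace HN]
  {J : ModelWithCorners ℝ EN HN} [TopologicalSpace N] [ChartedSpace HN N]
  {EZ HZ Z : Type*} [NormedAddCommGroup EZ] [NormedSpace ℝ EZ] [TopologicalSpace HZ]
  {I : ModelWithCorners ℝ EZ HZ} [TopologicalSpace Z] [ChartedSpace HZ Z]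
  {V : Type*} [NormedAddCommGroup V] [NormedSpace ℝ V]

theorem contMDiff_of_uncurry [IsManifold I ∞ Z] [IsManifold J ∞ N] [J.Boundaryless]
    [CompactSpace Z] {f : N × Z → V} (hf : ContMDiff (J.prod I) 𝓘(ℝ, V) ∞ f)
    {F : N → C(Z, V)} (hF : ∀ x z, F x z = f (x, z)) : ContMDiff J 𝓘(ℝ, C(Z, V)) ∞ F := by
  intro x₀
  have hU : IsOpen (extChartAt J x₀).target := isOpen_extChartAt_target x₀
  have h1 : ContMDiffOn (𝓘(ℝ, EN).prod I) 𝓘(ℝ, V) ∞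
      (fun p : EN × Z => f ((extChartAt J x₀).symm p.1, p.2))
      ((extChartAt J x₀).target ×ˢ Set.univ) := by
    refine hf.comp_contMDiffOn (ContMDiffOn.prodMk ?_ contMDiffOn_snd)
    exact (contMDiffOn_extChartAt_symm x₀).comp contMDiffOn_fst (fun p hp => hp.1)
  have h2 : ContDiffOn ℝ ∞ (fun y => F ((extChartAt J x₀).symm y)) (extChartAt J x₀).target :=
    contDiffOn_infty.2 fun m => contDiffOn_of_uncurry hU m h1 (fun x _ z => hF _ z)
  have h3 : ContMDiffAt J 𝓘(ℝ, C(Z, V)) ∞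
      (fun x => F ((extChartAt J x₀).symm (extChartAt J x₀ x))) x₀ := by
    have := (h2.contDiffAt (hU.mem_nhds (mem_extChartAt_target x₀))).contMDiffAt
    exact this.comp x₀ contMDiffAt_extChartAt
  refine h3.congr_of_eventuallyEq ?_
  filter_upwards [extChartAt_source_mem_nhds (I := J) x₀] with x hx
  rw [(extChartAt J x₀).left_inv hx]

theorem mfderiv_clm_comp {F : N → V} {x : N} (hF : MDifferentiableAt J 𝓘(ℝ, V) F x)
    {W : Type*} [NormedAddCommGroup W] [NormedSpace ℝ W] (Λ : V →L[ℝ] W) (X : TangentSpace J x) :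
    (mfderiv J 𝓘(ℝ, W) (fun x => Λ (F x)) x X : W) = Λ (mfderiv J 𝓘(ℝ, V) F x X : V) := by
  have h := (Λ.hasMFDerivAt (x := F x)).comp x hF.hasMFDerivAt
  exact DFunLike.congr_fun (h.mfderiv :) X

/-- Differentiation under a continuous linear functional of the parameter. -/
theorem mfderiv_clm_uncurry [IsManifold I ∞ Z] [IsManifold J ∞ N] [J.Boundaryless]
    [CompactSpace Z] {f : N × Z → V} (hf : ContMDiff (J.prod I) 𝓘(ℝ, V) ∞ f)
    {F : N → C(Z, V)} (hF : ∀ x z, F x z = f (x, z))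
    {W : Type*} [NormedAddCommGroup W] [NormedSpace ℝ W] (Λ : C(Z, V) →L[ℝ] W)
    {x : N} {X : TangentSpace J x} {D : C(Z, V)}
    (hD : ∀ z, D z = (mfderiv J 𝓘(ℝ, V) (fun x => f (x, z)) x X : V)) :
    (mfderiv J 𝓘(ℝ, W) (fun x => Λ (F x)) x X : W) = Λ D := by
  have hFs : MDifferentiableAt J 𝓘(ℝ, C(Z, V)) F x :=
    (contMDiff_of_uncurry hf hF x).mdifferentiableAt (by simp)
  have hD' : D = (mfderiv J 𝓘(ℝ, C(Z, V)) F x X : C(Z, V)) := by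
    ext z
    have := mfderiv_clm_comp hFs (ContinuousMap.evalCLM ℝ z : C(Z, V) →L[ℝ] V) X
    refine (hD z).trans (Eq.trans ?_ this)
    exact congrArg (fun g : N → V => (mfderiv J 𝓘(ℝ, V) g x X : V))
      (funext fun x => (hF x z).symm)
  rw [hD']
  exact mfderiv_clm_comp hFs Λ X

end CurryManifold

section LeftInvariant

variable {n : ℕ} {G : Type*} [Group G] [TopologicalSpace G]
  [ChartedSpace (EuclideanSpace ℝ (Fin n)) G] [LieGroup (𝓡 n) ∞ G]
  {V : Type*} [NormedAddCommGroup V] [NormedSpace ℂ V]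
  {W : Type*} [NormedAddCommGroup W] [NormedSpace ℂ W]

/-- The manifold derivative, read as a continuous linear map between the model spaces. -/
noncomputable def modelDeriv {E H M E' H' M' : Type*} [NormedAddCommGroup E] [NormedSpace ℝ E]
    [TopologicalSpace H] (I : ModelWithCorners ℝ E H) [TopologicalSpace M] [ChartedSpace H M]
    [NormedAddCommGroup E'] [NormedSpace ℝ E'] [TopologicalSpace H'] (I' : ModelWithCorners ℝ E' H')
    [TopologicalSpace M'] [ChartedSpace H' M'] (f : M → M') (x : M) : E →L[ℝ] E' :=
  mfderiv I I' f x

/-- The derivative at `1` of a smooth family of functions depends smoothly on the parameter. -/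
theorem contMDiff_mfderiv_one {V : Type*} [NormedAddCommGroup V] [NormedSpace ℝ V]
    {EN HN N : Type*} [NormedAddCommGroup EN] [NormedSpace ℝ EN]
    [TopologicalSpace HN] {J : ModelWithCorners ℝ EN HN} [TopologicalSpace N] [ChartedSpace HN N]
    [IsManifold J ∞ N] {f : N × G → V} (hf : ContMDiff (J.prod (𝓡 n)) 𝓘(ℝ, V) ∞ f) :
    ContMDiff J 𝓘(ℝ, EuclideanSpace ℝ (Fin n) →L[ℝ] V) ∞
      (fun x => modelDeriv (𝓡 n) 𝓘(ℝ, V) (fun z => f (x, z)) 1) := by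
  intro x₀
  have : IsManifold (𝓡 n) 1 G := IsManifold.of_le (n := ∞) (by simp)
  have h := ContMDiffAt.mfderiv (m := ∞) (x₀ := x₀) (fun (x : N) (z : G) => f (x, z))
    (fun _ => 1) hf.contMDiffAt contMDiffAt_const (by simp)
  refine h.congr_of_eventuallyEq (Filter.Eventually.of_forall fun x => ?_)
  have e := inTangentCoordinates_eq (I := 𝓡 n) (I' := 𝓘(ℝ, V)) (fun _ : N => (1 : G))
    (fun x => f (x, 1)) (fun x => modelDeriv (𝓡 n) 𝓘(ℝ, V) (fun z => f (x, z)) 1)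
    (x₀ := x₀) (x := x) (by simp) (mem_chart_source V (f (x, 1)))
  refine Eq.trans ?_ e.symm
  ext1 X
  simp only [ContinuousLinearMap.coe_comp, Function.comp_apply]
  rw [(tangentBundleCore (𝓡 n) G).coordChange_self _ _ (by simp)]
  simp

theorem leftInvDeriv_eq {u : G → V} (hu : ContMDiff (𝓡 n) 𝓘(ℝ, V) ∞ u)
    (X : GroupLieAlgebra (𝓡 n) G) (g : G) :
    leftInvDeriv n X u g = modelDeriv (𝓡 n) 𝓘(ℝ, V) (fun z => u (g * z)) 1 X := by
  have h1 : MDifferentiableAt (𝓡 n) (𝓡 n) (fun z : G => g * z) 1 :=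
    (contMDiff_mul_left (I := 𝓡 n) (n := ∞)).mdifferentiableAt (by simp)
  have h2 : MDifferentiableAt (𝓡 n) 𝓘(ℝ, V) u (g * 1) := hu.mdifferentiableAt (by simp)
  have h := (h2.hasMFDerivAt.comp (1 : G) h1.hasMFDerivAt).mfderiv
  refine Eq.trans ?_ (DFunLike.congr_fun h X).symm
  simp only [leftInvDeriv, mulInvariantVectorField]
  congr 2
  simp

theorem contMDiff_leftInvDeriv_param
    {EN HN N : Type*} [NormedAddCommGroup EN] [NormedSpace ℝ EN]
    [TopologicalSpace HN] {J : ModelWithCorners ℝ EN HN} [TopologicalSpace N] [ChartedSpace HN N]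
    [IsManifold J ∞ N] {f : G × N → V} (hf : ContMDiff ((𝓡 n).prod J) 𝓘(ℝ, V) ∞ f)
    (X : GroupLieAlgebra (𝓡 n) G) :
    ContMDiff ((𝓡 n).prod J) 𝓘(ℝ, V) ∞
      (fun p : G × N => leftInvDeriv n X (fun x => f (x, p.2)) p.1) := by
  have h1 : ContMDiff (((𝓡 n).prod J).prod (𝓡 n)) 𝓘(ℝ, V) ∞
      (fun q : (G × N) × G => f (q.1.1 * q.2, q.1.2)) :=
    hf.comp (((contMDiff_fst.comp contMDiff_fst).mul contMDiff_snd).prodMk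
      (contMDiff_snd.comp contMDiff_fst))
  have h2 := (contMDiff_mfderiv_one h1).clm_apply
    (contMDiff_const (I' := 𝓘(ℝ, EuclideanSpace ℝ (Fin n)))
      (M' := EuclideanSpace ℝ (Fin n)) (c := X))
  refine h2.congr fun p => ?_
  exact leftInvDeriv_eq (hf.comp (contMDiff_id.prodMk contMDiff_const)) X p.1

theorem contMDiff_leftInvDeriv {u : G → V} (hu : ContMDiff (𝓡 n) 𝓘(ℝ, V) ∞ u)
    (X : GroupLieAlgebra (𝓡 n) G) : ContMDiff (𝓡 n) 𝓘(ℝ, V) ∞ (leftInvDeriv n X u) :=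
  (contMDiff_leftInvDeriv_param (J := 𝓡 n) (N := G) (f := fun p => u p.1)
    (hu.comp contMDiff_fst) X).comp (contMDiff_id.prodMk contMDiff_id)

theorem contMDiff_iterLeftInvDeriv {u : G → V} (hu : ContMDiff (𝓡 n) 𝓘(ℝ, V) ∞ u)
    (L : List (GroupLieAlgebra (𝓡 n) G)) :
    ContMDiff (𝓡 n) 𝓘(ℝ, V) ∞ (iterLeftInvDeriv n L u) := by
  induction L with
  | nil => exact hu
  | cons X L ih => exact contMDiff_leftInvDeriv ih X

theorem contMDiff_iterLeftInvDeriv_param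
    {EN HN N : Type*} [NormedAddCommGroup EN] [NormedSpace ℝ EN]
    [TopologicalSpace HN] {J : ModelWithCorners ℝ EN HN} [TopologicalSpace N] [ChartedSpace HN N]
    [IsManifold J ∞ N] {f : G × N → V} (hf : ContMDiff ((𝓡 n).prod J) 𝓘(ℝ, V) ∞ f)
    (L : List (GroupLieAlgebra (𝓡 n) G)) :
    ContMDiff ((𝓡 n).prod J) 𝓘(ℝ, V) ∞
      (fun p : G × N => iterLeftInvDeriv n L (fun x => f (x, p.2)) p.1) := by
  induction L with
  | nil => exact hf
  | cons X L ih => exact contMDiff_leftInvDeriv_param ih X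

omit [LieGroup (𝓡 n) ∞ G] in
theorem leftInvDeriv_clm {u : G → V} (hu : ContMDiff (𝓡 n) 𝓘(ℝ, V) ∞ u) (Λ : V →L[ℝ] W)
    (X : GroupLieAlgebra (𝓡 n) G) (g : G) :
    leftInvDeriv n X (fun x => Λ (u x)) g = Λ (leftInvDeriv n X u g) :=
  mfderiv_clm_comp (hu.mdifferentiableAt (by simp)) Λ _

theorem iterLeftInvDeriv_clm {u : G → V} (hu : ContMDiff (𝓡 n) 𝓘(ℝ, V) ∞ u) (Λ : V →L[ℝ] W)
    (L : List (GroupLieAlgebra (𝓡 n) G)) :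
    iterLeftInvDeriv n L (fun x => Λ (u x)) = fun g => Λ (iterLeftInvDeriv n L u g) := by
  induction L with
  | nil => rfl
  | cons X L ih =>
    funext g
    simp only [iterLeftInvDeriv, ih]
    exact leftInvDeriv_clm (contMDiff_iterLeftInvDeriv hu L) Λ X g

omit [LieGroup (𝓡 n) ∞ G] in
theorem leftInvDeriv_add {u v : G → V} (hu : ContMDiff (𝓡 n) 𝓘(ℝ, V) ∞ u)
    (hv : ContMDiff (𝓡 n) 𝓘(ℝ, V) ∞ v) (X : GroupLieAlgebra (𝓡 n) G) :
    leftInvDeriv n X (u + v) = leftInvDeriv n X u + leftInvDeriv n X v := by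
  funext g
  have h := ((hu.mdifferentiableAt (x := g) (by simp)).hasMFDerivAt.add
    (hv.mdifferentiableAt (x := g) (by simp)).hasMFDerivAt).mfderiv
  exact DFunLike.congr_fun h _

theorem iterLeftInvDeriv_add {u v : G → V} (hu : ContMDiff (𝓡 n) 𝓘(ℝ, V) ∞ u)
    (hv : ContMDiff (𝓡 n) 𝓘(ℝ, V) ∞ v) (L : List (GroupLieAlgebra (𝓡 n) G)) :
    iterLeftInvDeriv n L (u + v) = iterLeftInvDeriv n L u + iterLeftInvDeriv n L v := by
  induction L with
  | nil => rfl
  | cons X L ih =>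
    simp only [iterLeftInvDeriv, ih]
    exact leftInvDeriv_add (contMDiff_iterLeftInvDeriv hu L) (contMDiff_iterLeftInvDeriv hv L) X

theorem iterLeftInvDeriv_smul {u : G → V} (hu : ContMDiff (𝓡 n) 𝓘(ℝ, V) ∞ u) (c : ℂ)
    (L : List (GroupLieAlgebra (𝓡 n) G)) :
    iterLeftInvDeriv n L (c • u) = c • iterLeftInvDeriv n L u :=
  iterLeftInvDeriv_clm hu ((c • ContinuousLinearMap.id ℂ V).restrictScalars ℝ) L

/-- Left-invariant differentiation as a linear map on `C^∞(G, V)`. -/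
noncomputable def iterLeftInvDerivₗ (L : List (GroupLieAlgebra (𝓡 n) G)) :
    smoothFunctions n G V →ₗ[ℂ] smoothFunctions n G V where
  toFun u := ⟨iterLeftInvDeriv n L u, contMDiff_iterLeftInvDeriv u.2 L⟩
  map_add' u v := Subtype.ext (iterLeftInvDeriv_add u.2 v.2 L)
  map_smul' c u := Subtype.ext (iterLeftInvDeriv_smul u.2 c L)

theorem leftInvDeriv_mul_left {u : G → V} (hu : ContMDiff (𝓡 n) 𝓘(ℝ, V) ∞ u) (a : G)
    (X : GroupLieAlgebra (𝓡 n) G) (g : G) :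
    leftInvDeriv n X (fun x => u (a * x)) g = leftInvDeriv n X u (a * g) := by
  rw [leftInvDeriv_eq (u := fun x => u (a * x)) (hu.comp contMDiff_mul_left), leftInvDeriv_eq hu]
  simp only [mul_assoc]

theorem iterLeftInvDeriv_mul_left {u : G → V} (hu : ContMDiff (𝓡 n) 𝓘(ℝ, V) ∞ u) (a : G)
    (L : List (GroupLieAlgebra (𝓡 n) G)) :
    iterLeftInvDeriv n L (fun x => u (a * x)) = fun g => iterLeftInvDeriv n L u (a * g) := by
  induction L with
  | nil => rfl
  | cons X L ih =>
    funext g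
    simp only [iterLeftInvDeriv, ih]
    exact leftInvDeriv_mul_left (contMDiff_iterLeftInvDeriv hu L) a X g

section Integral

variable [CompactSpace G]

/-- The values of a jointly smooth function as a continuous function of the parameter. -/
def sliceMap {f : G × G → V} (hf : ContMDiff ((𝓡 n).prod (𝓡 n)) 𝓘(ℝ, V) ∞ f) (g : G) : C(G, V) :=
  ⟨fun z => f (g, z), hf.continuous.comp (by fun_prop)⟩

theorem contMDiff_clm_slice {f : G × G → V} (hf : ContMDiff ((𝓡 n).prod (𝓡 n)) 𝓘(ℝ, V) ∞ f)
    (Λ : C(G, V) →L[ℝ] W) :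
    ContMDiff (𝓡 n) 𝓘(ℝ, W) ∞ (fun g => Λ (sliceMap hf g)) :=
  (Λ.contDiff.contMDiff).comp (contMDiff_of_uncurry hf (fun _ _ => rfl))

theorem iterLeftInvDeriv_clm_slice {f : G × G → V}
    (hf : ContMDiff ((𝓡 n).prod (𝓡 n)) 𝓘(ℝ, V) ∞ f) (Λ : C(G, V) →L[ℝ] W)
    (L : List (GroupLieAlgebra (𝓡 n) G)) :
    iterLeftInvDeriv n L (fun g => Λ (sliceMap hf g)) =
      fun g => Λ (sliceMap (contMDiff_iterLeftInvDeriv_param hf L) g) := by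
  induction L with
  | nil => rfl
  | cons X L ih =>
    funext g
    simp only [iterLeftInvDeriv, ih]
    exact mfderiv_clm_uncurry (contMDiff_iterLeftInvDeriv_param hf L) (fun _ _ => rfl) Λ
      (fun z => rfl)

end Integral

section Adjoint

/-- The adjoint action of `G` on its Lie algebra. -/
noncomputable def adjoint (n : ℕ) {G : Type*} [Group G] [TopologicalSpace G]
    [ChartedSpace (EuclideanSpace ℝ (Fin n)) G] (h : G) :
    EuclideanSpace ℝ (Fin n) →L[ℝ] EuclideanSpace ℝ (Fin n) :=
  modelDeriv (𝓡 n) (𝓡 n) (fun z : G => h * z * h⁻¹) 1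

theorem leftInvDeriv_mul_right {u : G → V} (hu : ContMDiff (𝓡 n) 𝓘(ℝ, V) ∞ u) (h : G)
    (X : GroupLieAlgebra (𝓡 n) G) (g : G) :
    leftInvDeriv n X (fun x => u (x * h)) g = leftInvDeriv n (adjoint n h⁻¹ X) u (g * h) := by
  refine (leftInvDeriv_eq (u := fun x => u (x * h)) (hu.comp contMDiff_mul_right) X g).trans
    (Eq.trans ?_ (leftInvDeriv_eq hu _ _).symm)
  have h1 : MDifferentiableAt (𝓡 n) (𝓡 n) (fun z : G => h⁻¹ * z * h⁻¹⁻¹) 1 :=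
    ((contMDiff_mul_right (I := 𝓡 n) (n := ∞)).comp
      (contMDiff_mul_left (I := 𝓡 n) (n := ∞))).mdifferentiableAt (by simp)
  have h2 : MDifferentiableAt (𝓡 n) 𝓘(ℝ, V) (fun z => u (g * h * z)) (h⁻¹ * 1 * h⁻¹⁻¹) :=
    (hu.comp contMDiff_mul_left).mdifferentiableAt (by simp)
  have h3 := (h2.hasMFDerivAt.comp (1 : G) h1.hasMFDerivAt).mfderiv
  have e : (fun x => u (g * x * h)) =
      (fun z => u (g * h * z)) ∘ (fun z : G => h⁻¹ * z * h⁻¹⁻¹) := by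
    funext x; simp [mul_assoc]
  refine Eq.trans (congrArg (fun f : G → V => modelDeriv (𝓡 n) 𝓘(ℝ, V) f 1 X) e) ?_
  refine Eq.trans (DFunLike.congr_fun h3 X) ?_
  have e1 : h⁻¹ * 1 * h⁻¹⁻¹ = 1 := by simp
  exact congrArg (fun p : G => (mfderiv (𝓡 n) 𝓘(ℝ, V) (fun z => u (g * h * z)) p :
    EuclideanSpace ℝ (Fin n) →L[ℝ] V) _) e1

theorem iterLeftInvDeriv_mul_right {u : G → V} (hu : ContMDiff (𝓡 n) 𝓘(ℝ, V) ∞ u) (h : G)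
    (L : List (GroupLieAlgebra (𝓡 n) G)) :
    iterLeftInvDeriv n L (fun x => u (x * h)) =
      fun g => iterLeftInvDeriv n (L.map fun X => (adjoint n h⁻¹ X : EuclideanSpace ℝ (Fin n)))
        u (g * h) := by
  induction L with
  | nil => rfl
  | cons X L ih =>
    funext g
    simp only [iterLeftInvDeriv, ih]
    exact leftInvDeriv_mul_right (contMDiff_iterLeftInvDeriv hu _) h X g

/-- The adjoint action depends continuously on the group element. -/
theorem continuous_adjoint : Continuous (adjoint n : G → _) := by
  rw [continuous_iff_continuousAt]
  intro h₀
  have : IsManifold (𝓡 n) 1 G := IsManifold.of_le (n := ∞) (by simp)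
  have hc : ContMDiff ((𝓡 n).prod (𝓡 n)) (𝓡 n) ∞ (fun p : G × G => p.1 * p.2 * p.1⁻¹) :=
    (contMDiff_fst.mul contMDiff_snd).mul contMDiff_fst.inv
  have h := ContMDiffAt.mfderiv (m := ∞) (x₀ := h₀) (fun (x : G) (z : G) => x * z * x⁻¹)
    (fun _ => 1) hc.contMDiffAt contMDiffAt_const (by simp)
  refine (h.continuousAt).congr (Filter.Eventually.of_forall fun x => ?_)
  have e1 : ∀ x : G, x * 1 * x⁻¹ = 1 := by simp
  have e2 := inTangentCoordinates_eq (I := 𝓡 n) (I' := 𝓡 n) (fun _ : G => (1 : G))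
    (fun x : G => x * 1 * x⁻¹) (adjoint n) (x₀ := h₀) (x := x) (by simp) (by simp)
  refine Eq.trans e2 ?_
  · ext1 X
    simp only [ContinuousLinearMap.coe_comp, Function.comp_apply]
    rw [(tangentBundleCore (𝓡 n) G).coordChange_self _ _ (by simp)]
    simp only [e1]
    rw [(tangentBundleCore (𝓡 n) G).coordChange_self _ _ (by simp)]

end Adjoint

end LeftInvariant

section WeightedIntegral

variable {G : Type*} [TopologicalSpace G] [CompactSpace G]
  {Y : Type*} [TopologicalSpace Y] [CompactSpace Y] [MeasurableSpace Y] [BorelSpace Y]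
  {V : Type*} [NormedAddCommGroup V] [NormedSpace ℂ V]

omit [NormedSpace ℂ V] in
theorem integrable_of_continuous (ν : Measure Y) [IsFiniteMeasure ν] {f : Y → V}
    (hf : Continuous f) : Integrable f ν :=
  hf.integrable_of_hasCompactSupport (HasCompactSupport.of_compactSpace f)

/-- The functional `f ↦ ∫ f(c(y)) w(y) dν(y)` on continuous functions. -/
noncomputable def weightedIntegral (ν : Measure Y) [IsFiniteMeasure ν] (c : C(Y, G)) (w : C(Y, V)) :
    C(G, ℂ) →L[ℂ] V :=
  LinearMap.mkContinuous
    { toFun := fun f => ∫ y, f (c y) • w y ∂ν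
      map_add' := fun f g => by
        simp only [ContinuousMap.add_apply, add_smul]
        exact integral_add (integrable_of_continuous ν (by fun_prop))
          (integrable_of_continuous ν (by fun_prop))
      map_smul' := fun a f => by
        simp only [ContinuousMap.smul_apply, smul_eq_mul, mul_smul, RingHom.id_apply]
        exact integral_smul a _ } (‖w‖ * ν.real Set.univ) (by
    intro f
    refine (norm_integral_le_of_norm_le_const (C := ‖f‖ * ‖w‖)
      (Filter.Eventually.of_forall fun y => ?_)).trans
        (by linarith [mul_comm ‖f‖ (‖w‖ * ν.real Set.univ)])
    rw [norm_smul]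
    gcongr
    · exact f.norm_coe_le_norm _
    · exact w.norm_coe_le_norm _)

theorem weightedIntegral_apply (ν : Measure Y) [IsFiniteMeasure ν] (c : C(Y, G)) (w : C(Y, V))
    (f : C(G, ℂ)) : weightedIntegral ν c w f = ∫ y, f (c y) • w y ∂ν := rfl

end WeightedIntegral

section SmoothRep

variable {n : ℕ} {G : Type*} [Group G] [TopologicalSpace G]
  [ChartedSpace (EuclideanSpace ℝ (Fin n)) G] [LieGroup (𝓡 n) ∞ G] [CompactSpace G] [T2Space G]
  [MeasurableSpace G] [BorelSpace G]

/-- A strongly continuous finite-dimensional representation is smooth. -/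
theorem contMDiff_rep (μ : Measure G) [μ.IsHaarMeasure]
    {V : Type*} [NormedAddCommGroup V] [InnerProductSpace ℂ V]
    [FiniteDimensional ℂ V] (ρ : Representation ℂ G V) (hρ : ∀ v, Continuous fun g => ρ g v)
    (v : V) : ContMDiff (𝓡 n) 𝓘(ℝ, V) ∞ (fun g => ρ g v) := by
  have : IsTopologicalGroup G := topologicalGroup_of_lieGroup (𝓡 n) ∞
  let S : Submodule ℂ V :=
    { carrier := {w | (fun g => ρ g w) ∈ smoothFunctions n G V}
      add_mem' := fun {a b} ha hb => by
        have := (smoothFunctions n G V).add_mem (x := fun g => ρ g a) (y := fun g => ρ g b) ha hb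
        simpa [Pi.add_def] using this
      zero_mem' := by
        have : (fun g => ρ g 0) = (0 : G → V) := by ext; simp
        change (fun g => ρ g 0) ∈ smoothFunctions n G V
        rw [this]
        exact (smoothFunctions n G V).zero_mem
      smul_mem' := fun c a ha => by
        have := (smoothFunctions n G V).smul_mem c ha
        simpa [Pi.smul_def] using this }
  suffices h : S = ⊤ by
    have : v ∈ S := h ▸ Submodule.mem_top
    exact this
  by_contra hS
  have hS' : Sᗮ ≠ ⊥ := fun h => hS (Submodule.orthogonal_eq_bot_iff.1 h)
  obtain ⟨w, hw, hw0⟩ := Submodule.exists_mem_ne_zero_of_ne_bot hS'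
  -- averages of `w` against bump functions lie in `S`
  have avg : ∀ φ : G → ℝ, ContMDiff (𝓡 n) 𝓘(ℝ, ℝ) ∞ φ →
      (∫ y, (φ y : ℂ) • ρ y w ∂μ) ∈ S := by
    intro φ hφ
    have hφc : ContMDiff (𝓡 n) 𝓘(ℝ, ℂ) ∞ (fun y => (φ y : ℂ)) :=
      Complex.ofRealCLM.contDiff.contMDiff.comp hφ
    have hf : ContMDiff ((𝓡 n).prod (𝓡 n)) 𝓘(ℝ, ℂ) ∞
        (fun p : G × G => (φ (p.1⁻¹ * p.2) : ℂ)) :=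
      hφc.comp (contMDiff_fst.inv.mul contMDiff_snd)
    have h1 := contMDiff_clm_slice hf ((weightedIntegral μ (ContinuousMap.id G)
      ⟨fun y => ρ y w, hρ w⟩).restrictScalars ℝ)
    refine h1.congr fun g => ?_
    simp only [ContinuousLinearMap.coe_restrictScalars', weightedIntegral_apply]
    change ρ g (∫ y, (φ y : ℂ) • ρ y w ∂μ) = ∫ y, (φ (g⁻¹ * y) : ℂ) • ρ y w ∂μ
    have h2 := integral_mul_left_eq_self (μ := μ) (fun y => (φ (g⁻¹ * y) : ℂ) • ρ y w) g
    rw [← h2]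
    have h3 := (LinearMap.toContinuousLinearMap (ρ g)).integral_comp_comm
      (integrable_of_continuous μ (f := fun y => (φ y : ℂ) • ρ y w)
        (hφc.continuous.smul (hρ w)))
    simp only [LinearMap.coe_toContinuousLinearMap'] at h3
    rw [← h3]
    simp
  have hcont : Continuous fun y => (⟪w, ρ y w⟫_ℂ).re :=
    Complex.continuous_re.comp (continuous_const.inner (hρ w))
  have hpos : 0 < (⟪w, ρ 1 w⟫_ℂ).re := by
    simp only [map_one, Module.End.one_apply]
    rw [← RCLike.re_eq_complex_re, inner_self_eq_norm_sq]
    positivity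
  have hU : {y | 0 < (⟪w, ρ y w⟫_ℂ).re} ∈ 𝓝 (1 : G) :=
    hcont.continuousAt.eventually (lt_mem_nhds hpos)
  obtain ⟨φ, -, hφ⟩ := (SmoothBumpFunction.nhds_basis_tsupport (I := 𝓡 n) (1 : G)).mem_iff.1 hU
  have hφs : ContMDiff (𝓡 n) 𝓘(ℝ, ℝ) ∞ φ := φ.contMDiff
  have horth := (Submodule.mem_orthogonal' _ _).1 hw _ (avg φ hφs)
  have hφc : Continuous (fun y => (φ y : ℂ)) := Complex.continuous_ofReal.comp hφs.continuous
  have hint : Integrable (fun y => (φ y : ℂ) • ρ y w) μ :=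
    integrable_of_continuous μ (hφc.smul (hρ w))
  rw [← integral_inner hint] at horth
  have hre : ∫ y, φ y * (⟪w, ρ y w⟫_ℂ).re ∂μ = 0 := by
    have h4 := congrArg Complex.re horth
    rw [← RCLike.re_eq_complex_re, ← integral_re] at h4
    · simpa only [inner_smul_right, RCLike.re_eq_complex_re, Complex.re_ofReal_mul,
        Complex.zero_re] using h4
    · exact integrable_of_continuous μ (continuous_const.inner (hφc.smul (hρ w)))
  have hpos' : 0 < ∫ y, φ y * (⟪w, ρ y w⟫_ℂ).re ∂μ := by
    refine Continuous.integral_pos_of_hasCompactSupport_nonneg_nonzero (x := 1)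
      (hφs.continuous.mul hcont) (HasCompactSupport.of_compactSpace _) ?_ ?_
    · intro y
      by_cases hy : y ∈ tsupport φ
      · exact mul_nonneg φ.nonneg (hφ hy).le
      · simp [image_eq_zero_of_notMem_tsupport hy]
    · simp only [φ.eq_one, one_mul]
      exact hpos.ne'
  exact hpos'.ne' hre

theorem contMDiff_matrix (μ : Measure G) [μ.IsHaarMeasure] (π : UnitaryIrrep G)
    (i j : Fin π.dim) : ContMDiff (𝓡 n) 𝓘(ℝ, ℂ) ∞ (fun g => π.matrix g i j) := by
  have h := contMDiff_rep (n := n) μ π.rep π.isIrreducibleUnitary.continuous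
    (EuclideanSpace.single j 1)
  exact (((EuclideanSpace.proj i : EuclideanSpace ℂ (Fin π.dim) →L[ℂ] ℂ).restrictScalars
    ℝ).contDiff.contMDiff).comp h

theorem UnitaryIrrep.isSmooth (μ : Measure G) [μ.IsHaarMeasure] (π : UnitaryIrrep G) :
    π.IsSmooth n := by
  intro i j
  exact (Complex.conjCLE.contDiff.contMDiff).comp (contMDiff_matrix μ π j i)

end SmoothRep

section SmoothTopology

variable {n : ℕ} {G : Type*} [Group G] [TopologicalSpace G]
  [ChartedSpace (EuclideanSpace ℝ (Fin n)) G]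
  {V : Type*} [NormedAddCommGroup V] [NormedSpace ℂ V]
  {W : Type*} [NormedAddCommGroup W] [NormedSpace ℂ W]

theorem tendsto_smoothTopology_iff {S : Submodule ℂ (G → V)} {ι : Type*} {l : Filter ι}
    {f : ι → S} {a : S} :
    Tendsto f l (@nhds S (smoothTopology n S) a) ↔ ∀ L : List (GroupLieAlgebra (𝓡 n) G),
      TendstoUniformly (fun i => iterLeftInvDeriv n L (f i : G → V))
        (iterLeftInvDeriv n L (a : G → V)) l := by
  rw [nhds_iInf, tendsto_iInf]
  refine forall_congr' fun L => ?_
  rw [nhds_induced, tendsto_comap_iff]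
  exact UniformFun.tendsto_iff_tendstoUniformly

theorem iterLeftInvDeriv_append (L L' : List (GroupLieAlgebra (𝓡 n) G)) (u : G → V) :
    iterLeftInvDeriv n (L ++ L') u = iterLeftInvDeriv n L (iterLeftInvDeriv n L' u) := by
  induction L with
  | nil => rfl
  | cons X L ih => simp only [List.cons_append, iterLeftInvDeriv, ih]

variable [LieGroup (𝓡 n) ∞ G]

theorem iterLeftInvDeriv_sub {S : Submodule ℂ (G → V)}
    (hS : S ≤ smoothFunctions n G V) (L : List (GroupLieAlgebra (𝓡 n) G)) (u v : S) :
    iterLeftInvDeriv n L ((u - v : S) : G → V) =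
      iterLeftInvDeriv n L (u : G → V) - iterLeftInvDeriv n L (v : G → V) := by
  have h := congrArg (fun f : smoothFunctions n G V => (f : G → V))
    (map_sub (iterLeftInvDerivₗ (n := n) (G := G) (V := V) L) ⟨u, hS u.2⟩ ⟨v, hS v.2⟩)
  exact h

theorem continuous_smoothTopology_of_bound {S : Submodule ℂ (G → V)} {S' : Submodule ℂ (G → W)}
    (hS : S ≤ smoothFunctions n G V) (hS' : S' ≤ smoothFunctions n G W) (T : S →ₗ[ℂ] S')
    (hT : ∀ L : List (GroupLieAlgebra (𝓡 n) G), ∃ 𝓙 : Set (List (GroupLieAlgebra (𝓡 n) G)),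
      𝓙.Finite ∧ ∃ C : ℝ, 0 ≤ C ∧ ∀ (u : S) (ε : ℝ),
        (∀ J ∈ 𝓙, ∀ g, ‖iterLeftInvDeriv n J (u : G → V) g‖ ≤ ε) →
          ∀ g, ‖iterLeftInvDeriv n L (T u : G → W) g‖ ≤ C * ε) :
    Continuous[smoothTopology n S, smoothTopology n S'] T := by
  let _ := smoothTopology n S
  let _ := smoothTopology n S'
  rw [continuous_iff_continuousAt]
  intro a
  refine tendsto_smoothTopology_iff.2 fun L => ?_
  obtain ⟨𝓙, hfin, C, hC, hb⟩ := hT L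
  have hid := tendsto_smoothTopology_iff.1 (tendsto_id (x := 𝓝 a))
  rw [Metric.tendstoUniformly_iff]
  intro ε hε
  have h1 : ∀ᶠ u : S in 𝓝 a, ∀ J ∈ 𝓙, ∀ g,
      dist (iterLeftInvDeriv n J (a : G → V) g) (iterLeftInvDeriv n J (u : G → V) g)
        < ε / (C + 1) := by
    rw [eventually_all_finite hfin]
    intro J _
    exact Metric.tendstoUniformly_iff.1 (hid J) _ (by positivity)
  filter_upwards [h1] with u hu g
  have h2 := hb (a - u) (ε / (C + 1)) (fun J hJ g => by
    rw [iterLeftInvDeriv_sub hS]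
    have := (hu J hJ g).le
    rwa [dist_eq_norm] at this) g
  rw [map_sub, iterLeftInvDeriv_sub hS'] at h2
  rw [dist_eq_norm]
  refine h2.trans_lt ?_
  rw [mul_div_assoc', div_lt_iff₀ (by positivity)]
  linarith

/-- `leftInvDeriv`, with the Lie algebra read as Euclidean space. -/
noncomputable def vecDeriv (X : EuclideanSpace ℝ (Fin n)) (u : G → V) : G → V :=
  leftInvDeriv n (X : GroupLieAlgebra (𝓡 n) G) u

/-- `iterLeftInvDeriv`, with the Lie algebra read as Euclidean space. -/
noncomputable def iterVecDeriv (L : List (EuclideanSpace ℝ (Fin n))) (u : G → V) : G → V :=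
  iterLeftInvDeriv n (G := G) L u

omit [LieGroup (𝓡 n) ∞ G] in
@[simp]
theorem iterVecDeriv_nil (u : G → V) :
    iterVecDeriv ([] : List (EuclideanSpace ℝ (Fin n))) u = u := rfl

omit [LieGroup (𝓡 n) ∞ G] in
theorem iterVecDeriv_append (L L' : List (EuclideanSpace ℝ (Fin n))) (u : G → V) :
    iterVecDeriv (L ++ L') u = iterVecDeriv L (iterVecDeriv L' u) :=
  iterLeftInvDeriv_append (G := G) L L' u

theorem contMDiff_vecDeriv {u : G → V} (hu : ContMDiff (𝓡 n) 𝓘(ℝ, V) ∞ u)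
    (X : EuclideanSpace ℝ (Fin n)) : ContMDiff (𝓡 n) 𝓘(ℝ, V) ∞ (vecDeriv X u) :=
  contMDiff_leftInvDeriv hu _

theorem contMDiff_iterVecDeriv {u : G → V} (hu : ContMDiff (𝓡 n) 𝓘(ℝ, V) ∞ u)
    (L : List (EuclideanSpace ℝ (Fin n))) : ContMDiff (𝓡 n) 𝓘(ℝ, V) ∞ (iterVecDeriv L u) :=
  contMDiff_iterLeftInvDeriv hu _

theorem iterVecDeriv_mul_right {u : G → V} (hu : ContMDiff (𝓡 n) 𝓘(ℝ, V) ∞ u) (h : G)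
    (L : List (EuclideanSpace ℝ (Fin n))) :
    iterVecDeriv L (fun x => u (x * h)) =
      fun g => iterVecDeriv (L.map (adjoint n h⁻¹)) u (g * h) :=
  iterLeftInvDeriv_mul_right hu h L

theorem vecDeriv_eq_sum {u : G → V} (hu : ContMDiff (𝓡 n) 𝓘(ℝ, V) ∞ u)
    (X : EuclideanSpace ℝ (Fin n)) :
    vecDeriv X u = ∑ j, ((X j : ℝ) : ℂ) • vecDeriv (EuclideanSpace.single j (1 : ℝ)) u := by
  funext g
  simp only [Finset.sum_apply, Pi.smul_apply]
  have h : X = ∑ j, X j • EuclideanSpace.single j (1 : ℝ) := by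
    have := (EuclideanSpace.basisFun (Fin n) ℝ).sum_repr X
    simpa using this.symm
  have h1 : ∀ Y : EuclideanSpace ℝ (Fin n), vecDeriv Y u g =
      modelDeriv (𝓡 n) 𝓘(ℝ, V) (fun z => u (g * z)) 1 Y := fun Y => leftInvDeriv_eq hu _ g
  simp only [h1]
  conv_lhs => rw [h]
  rw [map_sum]
  refine Finset.sum_congr rfl fun j _ => ?_
  rw [map_smul, Complex.coe_smul]

theorem iterVecDeriv_sum {ι : Type*} (s : Finset ι) (c : ι → ℂ) {w : ι → G → V}
    (hw : ∀ j, ContMDiff (𝓡 n) 𝓘(ℝ, V) ∞ (w j)) (L : List (EuclideanSpace ℝ (Fin n))) :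
    iterVecDeriv L (∑ j ∈ s, c j • w j) = ∑ j ∈ s, c j • iterVecDeriv L (w j) := by
  have h := congrArg (fun f : smoothFunctions n G V => (f : G → V))
    (map_sum (iterLeftInvDerivₗ (n := n) (G := G) (V := V) L)
      (fun j => c j • (⟨w j, hw j⟩ : smoothFunctions n G V)) s)
  simp only [map_smul, Submodule.coe_sum, Submodule.coe_smul] at h
  refine Eq.trans ?_ h
  change iterVecDeriv L _ = iterVecDeriv L _
  congr 1
  simp only [Submodule.coe_sum, Submodule.coe_smul]

theorem norm_iterVecDeriv_le {R ε : ℝ} (L : List (EuclideanSpace ℝ (Fin n)))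
    (hL : ∀ X ∈ L, ‖X‖ ≤ R) {u : G → V} (hu : ContMDiff (𝓡 n) 𝓘(ℝ, V) ∞ u)
    (h : ∀ J : List (Fin n), J.length = L.length → ∀ g,
      ‖iterVecDeriv (J.map fun j => EuclideanSpace.single j (1 : ℝ)) u g‖ ≤ ε) (g : G) :
    ‖iterVecDeriv L u g‖ ≤ (n * R) ^ L.length * ε := by
  induction L using List.reverseRecOn generalizing ε u g with
  | nil => simpa using h [] rfl g
  | append_singleton L X ih =>
    have hX : ‖X‖ ≤ R := hL X (by simp)
    have h1 := ih (ε := n * R * ε) (fun Y hY => hL Y (by simp [hY])) (contMDiff_vecDeriv hu X)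
      (fun J hJ g => ?_) g
    · rw [iterVecDeriv_append]
      refine h1.trans (le_of_eq ?_)
      simp only [List.length_append, List.length_singleton]; ring
    · rw [vecDeriv_eq_sum hu, iterVecDeriv_sum _ _ (fun j => contMDiff_vecDeriv hu _)]
      simp only [Finset.sum_apply, Pi.smul_apply]
      refine (norm_sum_le _ _).trans ?_
      have h4 : ∀ j ∈ Finset.univ, ‖((X j : ℝ) : ℂ) • iterVecDeriv
            (J.map fun j => EuclideanSpace.single j (1 : ℝ))
              (vecDeriv (EuclideanSpace.single j (1 : ℝ)) u) g‖ ≤ R * ε := by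
        intro j _
        rw [norm_smul, Complex.norm_real]
        have := h (J ++ [j]) (by simp [hJ]) g
        rw [List.map_append, iterVecDeriv_append] at this
        gcongr
        · exact (norm_nonneg _).trans hX
        · exact (PiLp.norm_apply_le X j).trans hX
        · exact this
      refine (Finset.sum_le_sum h4).trans (le_of_eq ?_)
      simp; ring

/-- The derivatives of right translates of `u` are controlled uniformly by finitely many derivatives
of `u`. -/
theorem exists_norm_iterVecDeriv_mul_right_le [CompactSpace G]
    (L : List (EuclideanSpace ℝ (Fin n))) :
    ∃ 𝓙 : Set (List (EuclideanSpace ℝ (Fin n))), 𝓙.Finite ∧ ∃ C : ℝ, 0 ≤ C ∧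
      ∀ {u : G → V}, ContMDiff (𝓡 n) 𝓘(ℝ, V) ∞ u → ∀ ε : ℝ,
        (∀ J ∈ 𝓙, ∀ g, ‖iterVecDeriv J u g‖ ≤ ε) →
          ∀ h g, ‖iterVecDeriv L (fun x => u (x * h)) g‖ ≤ C * ε := by
  obtain ⟨M, hM⟩ : ∃ M : ℝ, ∀ X ∈ L, ‖X‖ ≤ M := by
    obtain ⟨M, hM⟩ := (L.toFinset.finite_toSet.image fun X => ‖X‖).bddAbove
    exact ⟨M, fun X hX => hM ⟨X, by simpa using hX, rfl⟩⟩
  obtain ⟨B, hB⟩ :=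
    (isCompact_range (continuous_adjoint (n := n) (G := G))).isBounded.exists_norm_le
  set R : ℝ := max B 0 * max M 0 with hRdef
  have hR : 0 ≤ R := by positivity
  refine ⟨(fun J : List (Fin n) => J.map fun j => EuclideanSpace.single j (1 : ℝ)) ''
    {J | J.length = L.length}, (List.finite_length_eq (Fin n) L.length).image _,
    (n * R) ^ L.length, by positivity, ?_⟩
  intro u hu ε hε h g
  rw [iterVecDeriv_mul_right hu]
  have h1 := norm_iterVecDeriv_le (G := G) (V := V) (ε := ε) (R := R)
    (L.map (adjoint n h⁻¹)) (by
      intro Y hY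
      obtain ⟨X, hX, rfl⟩ := List.mem_map.1 hY
      refine ((adjoint n h⁻¹).le_opNorm _).trans ?_
      rw [hRdef]
      gcongr
      · exact (hB _ ⟨h⁻¹, rfl⟩).trans (le_max_left _ _)
      · exact (hM X hX).trans (le_max_left _ _)) hu (by
      intro J hJ g
      exact hε _ ⟨J, by simpa using hJ, rfl⟩ g) (g * h)
  simpa using h1

end SmoothTopology

/-- Haar measure on a compact group is right-invariant. -/
theorem isMulRightInvariant_of_compactSpace {G : Type*} [Group G] [TopologicalSpace G]
    [IsTopologicalGroup G] [CompactSpace G] [MeasurableSpace G] [BorelSpace G] (μ : Measure G)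
    [μ.IsHaarMeasure] : μ.IsMulRightInvariant := by
  refine ⟨fun g => ?_⟩
  have h := Measure.isMulInvariant_eq_smul_of_compactSpace (μ.map (· * g)) μ
  have h1 := congrArg (fun m : Measure G => m Set.univ) h
  simp only [Measure.smul_apply] at h1
  rw [Measure.map_apply (measurable_mul_const g) MeasurableSet.univ, Set.preimage_univ] at h1
  have h0 : μ Set.univ ≠ 0 := (isOpen_univ.measure_pos μ Set.univ_nonempty).ne'
  have hf : μ Set.univ ≠ ⊤ := measure_ne_top μ _
  have h2 : Measure.haarScalarFactor (μ.map (· * g)) μ = 1 := by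
    have : (1 : ENNReal) * μ Set.univ =
        (Measure.haarScalarFactor (μ.map (· * g)) μ : ENNReal) * μ Set.univ := by
      rw [one_mul]; exact h1
    exact_mod_cast ((ENNReal.mul_left_inj h0 hf).1 this).symm
  rw [h, h2, one_smul]

theorem smoothSections_le {n : ℕ} {G : Type*} [Group G] [TopologicalSpace G]
    [ChartedSpace (EuclideanSpace ℝ (Fin n)) G] {V : Type*} [NormedAddCommGroup V]
    [NormedSpace ℂ V] {K : Subgroup G} {τ : Representation ℂ K V} :
    smoothSections n τ ≤ smoothFunctions n G V := fun _ hu => And.left hu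

section Average

variable {n : ℕ} {G : Type*} [Group G] [TopologicalSpace G]
  [ChartedSpace (EuclideanSpace ℝ (Fin n)) G] [LieGroup (𝓡 n) ∞ G] [CompactSpace G]
  {K : Subgroup G} [CompactSpace K] [MeasurableSpace K] [BorelSpace K]
  {E₀ : Type*} [NormedAddCommGroup E₀] [InnerProductSpace ℂ E₀]

omit [CompactSpace G] in
theorem contMDiff_right_slice {φ : G → ℂ} (hφ : ContMDiff (𝓡 n) 𝓘(ℝ, ℂ) ∞ φ) :
    ContMDiff ((𝓡 n).prod (𝓡 n)) 𝓘(ℝ, ℂ) ∞ (fun p : G × G => φ (p.1 * p.2)) :=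
  hφ.comp (contMDiff_fst.mul contMDiff_snd)

/-- The section `g ↦ ∫_K φ(g h) τ(h) v dh` obtained by averaging `φ ⊗ v` over `K`. -/
noncomputable def averageFun (ν : Measure K) (τ : Representation ℂ K E₀) (v : E₀) (φ : G → ℂ)
    (g : G) : E₀ :=
  ∫ h : K, φ (g * h) • τ h v ∂ν

variable (ν : Measure K) [IsFiniteMeasure ν] {τ : Representation ℂ K E₀}
  (hτ : ∀ v, Continuous fun h => τ h v)

theorem averageFun_eq (v : E₀) {φ : G → ℂ} (hφ : ContMDiff (𝓡 n) 𝓘(ℝ, ℂ) ∞ φ) :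
    averageFun ν τ v φ = fun g => (weightedIntegral ν ⟨((↑) : K → G), continuous_subtype_val⟩
      ⟨fun h => τ h v, hτ v⟩).restrictScalars ℝ (sliceMap (contMDiff_right_slice hφ) g) := rfl

include hτ in
theorem contMDiff_averageFun (v : E₀) {φ : G → ℂ} (hφ : ContMDiff (𝓡 n) 𝓘(ℝ, ℂ) ∞ φ) :
    ContMDiff (𝓡 n) 𝓘(ℝ, E₀) ∞ (averageFun ν τ v φ) := by
  rw [averageFun_eq ν hτ v hφ]
  exact contMDiff_clm_slice _ _

omit [CompactSpace G] in
include hτ in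
theorem averageFun_mul [IsTopologicalGroup G] [ν.IsMulLeftInvariant] [FiniteDimensional ℂ E₀]
    (v : E₀) {φ : G → ℂ} (hφ : Continuous φ) (g : G) (k : K) :
    averageFun ν τ v φ (g * k) = τ k⁻¹ (averageFun ν τ v φ g) := by
  have h1 := (LinearMap.toContinuousLinearMap (τ k⁻¹)).integral_comp_comm
    (integrable_of_continuous ν (f := fun h : K => φ (g * h) • τ h v)
      ((hφ.comp (by fun_prop)).smul (hτ v)))
  have h2 := integral_mul_left_eq_self (μ := ν)
    (fun h : K => φ (g * h) • τ (k⁻¹ * h) v) k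
  simp only [LinearMap.coe_toContinuousLinearMap', map_smul] at h1
  simp only [averageFun]
  rw [← h1]
  simp only [← Module.End.mul_apply, ← map_mul]
  rw [← h2]
  simp [mul_assoc]

omit [CompactSpace G] [CompactSpace K] [IsFiniteMeasure ν] in
theorem averageFun_rightTranslate [IsTopologicalGroup G] [ν.IsMulRightInvariant] (v : E₀)
    (φ : G → ℂ) (h : K) (g : G) :
    averageFun ν τ v (fun y => φ (y * (h : G)⁻¹)) g = averageFun ν τ (τ h v) φ g := by
  have h2 := integral_mul_right_eq_self (μ := ν)
    (fun k : K => φ (g * (k * (h : G)⁻¹)) • τ k v) h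
  simp only [averageFun, mul_assoc]
  rw [← h2]
  simp [mul_assoc]

include hτ in
/-- The averaging map is controlled by finitely many derivatives. -/
theorem exists_norm_averageFun_le (v : E₀) (L : List (EuclideanSpace ℝ (Fin n))) :
    ∃ 𝓙 : Set (List (EuclideanSpace ℝ (Fin n))), 𝓙.Finite ∧ ∃ C : ℝ, 0 ≤ C ∧
      ∀ {φ : G → ℂ}, ContMDiff (𝓡 n) 𝓘(ℝ, ℂ) ∞ φ → ∀ ε : ℝ,
        (∀ J ∈ 𝓙, ∀ g, ‖iterVecDeriv J φ g‖ ≤ ε) →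
          ∀ g, ‖iterVecDeriv L (averageFun ν τ v φ) g‖ ≤ C * ε := by
  obtain ⟨𝓙, hfin, C, hC, hb⟩ := exists_norm_iterVecDeriv_mul_right_le (G := G) (V := ℂ) L
  set Λ : C(G, ℂ) →L[ℂ] E₀ := weightedIntegral ν ⟨((↑) : K → G), continuous_subtype_val⟩
      ⟨fun h => τ h v, hτ v⟩
  refine ⟨𝓙, hfin, ‖Λ‖ * C, by positivity, fun {φ} hφ ε hε g => ?_⟩
  have h1 : iterVecDeriv L (averageFun ν τ v φ) g =
      Λ (sliceMap (contMDiff_iterLeftInvDeriv_param (contMDiff_right_slice hφ) L) g) := by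
    rw [averageFun_eq ν hτ v hφ]
    exact congrFun (iterLeftInvDeriv_clm_slice (contMDiff_right_slice hφ)
      (Λ.restrictScalars ℝ) L) g
  rw [h1, mul_assoc]
  refine (Λ.le_opNorm _).trans ?_
  gcongr
  exact (ContinuousMap.norm_le _ ((norm_nonneg _).trans (hb hφ ε hε 1 1))).2
    fun z => hb hφ ε hε z g

variable [FiniteDimensional ℂ E₀] [ν.IsMulLeftInvariant]

/-- Averaging over `K`, as a map from `C^∞(G) × E₀` to the smooth sections. -/
noncomputable def averageSection :
    smoothFunctions n G ℂ →ₗ[ℂ] E₀ →ₗ[ℂ] smoothSections n τ :=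
  have : IsTopologicalGroup G := topologicalGroup_of_lieGroup (𝓡 n) ∞
  have hint : ∀ (φ : smoothFunctions n G ℂ) (v : E₀) (g : G),
      Integrable (fun h : K => (φ : G → ℂ) (g * h) • τ h v) ν := fun φ v g =>
    integrable_of_continuous ν ((φ.2.continuous.comp (by fun_prop)).smul (hτ v))
  LinearMap.mk₂ ℂ (fun φ v => ⟨averageFun ν τ v φ, contMDiff_averageFun ν hτ v φ.2,
      averageFun_mul ν hτ v φ.2.continuous⟩)
    (fun φ ψ v => Subtype.ext <| funext fun g =>
      (integral_congr_ae (Eventually.of_forall fun h => add_smul _ _ _)).trans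
        (integral_add (hint φ v g) (hint ψ v g)))
    (fun c φ v => Subtype.ext <| funext fun g =>
      (integral_congr_ae (Eventually.of_forall fun h => smul_assoc _ _ _)).trans
        (integral_smul c _))
    (fun φ v w => Subtype.ext <| funext fun g =>
      (integral_congr_ae (Eventually.of_forall fun h => by
        simp only [map_add, smul_add])).trans
        (integral_add (hint φ v g) (hint φ w g)))
    (fun c φ v => Subtype.ext <| funext fun g =>
      (integral_congr_ae (Eventually.of_forall fun h => by
        simp only [map_smul]; exact smul_comm _ _ _)).trans (integral_smul c _))

theorem averageSection_apply (φ : smoothFunctions n G ℂ) (v : E₀) :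
    (averageSection ν hτ φ v : G → E₀) = averageFun ν τ v φ := rfl

theorem continuous_averageSection (v : E₀) :
    Continuous[smoothTopology n (smoothFunctions n G ℂ), smoothTopology n (smoothSections n τ)]
      ((averageSection (n := n) ν hτ).flip v) :=
  continuous_smoothTopology_of_bound le_rfl smoothSections_le _ fun L => by
    obtain ⟨𝓙, hfin, C, hC, hb⟩ := exists_norm_averageFun_le (G := G) ν hτ v L
    exact ⟨𝓙, hfin, C, hC, fun u ε hε g => hb u.2 ε hε g⟩

theorem sum_averageSection_component [IsProbabilityMeasure ν] (u : smoothSections n τ) :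
    ∑ a, averageSection ν hτ (component (stdOrthonormalBasis ℂ E₀ a) (toSmooth u))
      (stdOrthonormalBasis ℂ E₀ a) = u := by
  have : IsTopologicalGroup G := topologicalGroup_of_lieGroup (𝓡 n) ∞
  refine Subtype.ext (funext fun g => ?_)
  rw [Submodule.coe_sum, Finset.sum_apply]
  simp only [averageSection_apply, averageFun]
  rw [← integral_finsetSum]
  · have h1 : ∀ h : K, ∑ a,
        ((component (stdOrthonormalBasis ℂ E₀ a) (toSmooth u) : G → ℂ) (g * h)) •
          τ h (stdOrthonormalBasis ℂ E₀ a) = (u : G → E₀) g := by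
      intro h
      simp only [← map_smul, ← map_sum]
      have h2 := (stdOrthonormalBasis ℂ E₀).sum_repr' ((u : G → E₀) (g * h))
      refine (congrArg (τ h) h2).trans ?_
      rw [u.2.2 g h, ← Module.End.mul_apply, ← map_mul]
      simp
    simp only [h1]
    simp
  · intro a _
    exact integrable_of_continuous ν (((component _ (toSmooth u)).2.continuous.comp
      (by fun_prop)).smul (hτ _))

end Average

section Existence

variable {n : ℕ} {G : Type*} [Group G] [TopologicalSpace G]
  [ChartedSpace (EuclideanSpace ℝ (Fin n)) G] [LieGroup (𝓡 n) ∞ G] [CompactSpace G]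
  [MeasurableSpace G] [BorelSpace G]
  {K : Subgroup G}
  {E₀ : Type*} [NormedAddCommGroup E₀] [InnerProductSpace ℂ E₀] [FiniteDimensional ℂ E₀]
  {F₀ : Type*} [NormedAddCommGroup F₀] [InnerProductSpace ℂ F₀]

omit [LieGroup (𝓡 n) ∞ G] [CompactSpace G] [MeasurableSpace G] [BorelSpace G] in
theorem continuous_eval_section {τF : Representation ℂ K F₀} (x : G) :
    @Continuous _ _ (smoothTopology n (smoothSections n τF)) _
      (fun u : smoothSections n τF => (u : G → F₀) x) := by
  let _ := smoothTopology n (smoothSections n τF)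
  rw [continuous_iff_continuousAt]
  intro a
  exact (tendsto_smoothTopology_iff.1 (tendsto_id (x := 𝓝 a)) []).tendsto_at x

theorem exists_isSchwartzKernel (hK : IsClosed (K : Set G))
    {τE : Representation ℂ K E₀} (hτ : ∀ v, Continuous fun h => τE h v)
    {τF : Representation ℂ K F₀} (A : smoothSections n τE →ₗ[ℂ] smoothSections n τF)
    (hA : Continuous[smoothTopology n (smoothSections n τE),
      smoothTopology n (smoothSections n τF)] A) :
    ∃ k : G → HomDistribution n G E₀ F₀, IsSchwartzKernel A k := by
  have : IsTopologicalGroup G := topologicalGroup_of_lieGroup (𝓡 n) ∞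
  have : CompactSpace K := isCompact_iff_compactSpace.1 hK.isCompact
  let ν : Measure K := Measure.haarMeasure ⊤
  have : IsProbabilityMeasure ν := ⟨Measure.haarMeasure_self (K₀ := ⊤)⟩
  have : ν.IsMulRightInvariant := isMulRightInvariant_of_compactSpace ν
  let ev : G → smoothSections n τF →ₗ[ℂ] F₀ := fun x =>
    (LinearMap.proj x).comp (smoothSections n τF).subtype
  let T : G → smoothFunctions n G ℂ →ₗ[ℂ] (E₀ →L[ℂ] F₀) := fun x =>
    { toFun := fun φ => LinearMap.toContinuousLinearMap (ev x ∘ₗ A ∘ₗ averageSection ν hτ φ)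
      map_add' := fun φ ψ => by ext v; simp
      map_smul' := fun c φ => by ext v; simp }
  have hT : ∀ x φ v, T x φ v = (A (averageSection ν hτ φ v) : G → F₀) x := fun _ _ _ => rfl
  refine ⟨fun x => ⟨T x, ?_⟩, ⟨?_, ?_⟩⟩
  · let _ := smoothTopology n (smoothFunctions n G ℂ)
    let _ := smoothTopology n (smoothSections n τE)
    let _ := smoothTopology n (smoothSections n τF)
    rw [continuous_clm_apply]
    intro v
    exact (continuous_eval_section x).comp (hA.comp (continuous_averageSection ν hτ v))
  · intro u x
    simp only [HomDistribution.pair, hT]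
    conv_lhs => rw [← sum_averageSection_component ν hτ u]
    rw [map_sum, Submodule.coe_sum, Finset.sum_apply]
  · intro x h φ v
    simp only [hT]
    refine congrArg (fun w => (A w : G → F₀) x) (Subtype.ext (funext fun g => ?_))
    exact averageFun_rightTranslate ν v φ h g

end Existence

section Invariant

variable {G : Type*} [Group G] [TopologicalSpace G]
  {H : Type*} [NormedAddCommGroup H] [InnerProductSpace ℂ H]

theorem isCompactOperator_rankOne (x y : H) :
    IsCompactOperator (InnerProductSpace.rankOne ℂ x y : H →L[ℂ] H) := by
  have h : IsCompactOperator (ContinuousLinearMap.toSpanSingleton ℂ x) :=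
    isCompactOperator_of_locallyCompactSpace_rng (ContinuousLinearMap.toSpanSingleton ℂ x)
  exact h.comp_clm (innerSL ℂ y)

omit [TopologicalSpace G] in
theorem isIrreducible_iff {V : Type*} [AddCommGroup V] [Module ℂ V] (ρ : Representation ℂ G V) :
    ρ.IsIrreducible ↔ Nontrivial V ∧ ∀ W : Submodule ℂ V, (∀ g, ∀ w ∈ W, ρ g w ∈ W) →
      W = ⊥ ∨ W = ⊤ := by
  constructor
  · intro h
    have hbt : (⊥ : Subrepresentation ρ) ≠ ⊤ := bot_ne_top
    refine ⟨?_, fun W hW => ?_⟩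
    · by_contra hV
      rw [not_nontrivial_iff_subsingleton] at hV
      exact hbt (Subrepresentation.toSubmodule_injective (Subsingleton.elim _ _))
    · rcases eq_bot_or_eq_top (⟨W, fun g w hw => hW g w hw⟩ : Subrepresentation ρ) with h1 | h1
      · exact Or.inl (congrArg Subrepresentation.toSubmodule h1)
      · exact Or.inr (congrArg Subrepresentation.toSubmodule h1)
  · rintro ⟨hV, h⟩
    have hbt : (⊥ : Subrepresentation ρ) ≠ ⊤ := fun h1 =>
      (bot_ne_top : (⊥ : Submodule ℂ V) ≠ ⊤) (congrArg Subrepresentation.toSubmodule h1)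
    exact
      { exists_pair_ne := ⟨_, _, hbt⟩
        eq_bot_or_eq_top := fun W => by
          rcases h W.toSubmodule (fun g w hw => W.apply_mem_toSubmodule g hw) with h1 | h1
          · exact Or.inl (Subrepresentation.toSubmodule_injective h1)
          · exact Or.inr (Subrepresentation.toSubmodule_injective h1) }

/-- Every nonzero vector of a unitary representation of a compact group generates a closed
subspace that contains a nonzero finite-dimensional invariant subspace. -/
theorem exists_finiteDimensional_invariant [CompleteSpace H] [IsTopologicalGroup G] [CompactSpace G]
    [MeasurableSpace G]
    [BorelSpace G] (μ : Measure G) [μ.IsHaarMeasure] [IsProbabilityMeasure μ]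
    (ρ : Representation ℂ G H) (hcont : ∀ v, Continuous fun g => ρ g v)
    (hunit : ∀ g v w, ⟪ρ g v, ρ g w⟫_ℂ = ⟪v, w⟫_ℂ) {ψ : H} (hψ : ψ ≠ 0) :
    ∃ W : Submodule ℂ H, FiniteDimensional ℂ W ∧ W ≠ ⊥ ∧ (∀ g, ∀ w ∈ W, ρ g w ∈ W) ∧
      ∀ m, (∀ z, ⟪m, ρ z ψ⟫_ℂ = 0) → ∀ w ∈ W, ⟪m, w⟫_ℂ = 0 := by
  have hadj : ∀ g v w, ⟪v, ρ g w⟫_ℂ = ⟪ρ g⁻¹ v, w⟫_ℂ := by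
    intro g v w
    rw [← hunit g (ρ g⁻¹ v) w, ← Module.End.mul_apply, ← map_mul]
    simp
  have hnorm : ∀ g v, ‖ρ g v‖ = ‖v‖ := by
    intro g v
    rw [@norm_eq_sqrt_re_inner ℂ, @norm_eq_sqrt_re_inner ℂ, hunit]
  let P : G → H →L[ℂ] H := fun z => InnerProductSpace.rankOne ℂ (ρ z ψ) (ρ z ψ)
  have hP : Continuous P :=
    ((ContinuousLinearMap.toSpanSingletonCLE (𝕜 := ℂ) (E := H)).continuous.comp (hcont ψ)).clm_comp
      ((innerSL ℂ (E := H)).continuous.comp (hcont ψ))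
  have hPint : Integrable P μ := integrable_of_continuous μ hP
  let T : H →L[ℂ] H := ∫ z, P z ∂μ
  have hT : ∀ v, T v = ∫ z, ⟪ρ z ψ, v⟫_ℂ • ρ z ψ ∂μ := fun v =>
    ContinuousLinearMap.integral_apply hPint v
  have hTint : ∀ v, Integrable (fun z => ⟪ρ z ψ, v⟫_ℂ • ρ z ψ) μ := fun v =>
    integrable_of_continuous μ (((hcont ψ).inner continuous_const).smul (hcont ψ))
  have hTin : ∀ m v, ⟪m, T v⟫_ℂ = ∫ z, ⟪ρ z ψ, v⟫_ℂ * ⟪m, ρ z ψ⟫_ℂ ∂μ := by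
    intro m v
    rw [hT, ← integral_inner (hTint v)]
    simp only [inner_smul_right]
  have hTcomp : IsCompactOperator T := by
    have hconv : Convex ℝ {S : H →L[ℂ] H | IsCompactOperator S} :=
      ((compactOperator (RingHom.id ℂ) H H).restrictScalars ℝ).convex
    exact hconv.integral_mem isClosed_setOfPred_isCompactOperator
      (Eventually.of_forall fun z => isCompactOperator_rankOne _ _) hPint
  have hTsymm : T.IsSymmetric := by
    intro v w
    change ⟪T v, w⟫_ℂ = ⟪v, T w⟫_ℂ
    rw [← inner_conj_symm, hTin, hTin, ← integral_conj]
    refine integral_congr_ae (Eventually.of_forall fun z => ?_)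
    simp only [map_mul, inner_conj_symm]
    exact mul_comm _ _
  have hTρ : ∀ g v, T (ρ g v) = ρ g (T v) := by
    intro g v
    refine ext_inner_left ℂ fun m => ?_
    rw [hadj, hTin, hTin, ← integral_mul_left_eq_self (μ := μ) _ g]
    refine integral_congr_ae (Eventually.of_forall fun z => ?_)
    simp only [map_mul, Module.End.mul_apply]
    rw [hunit, hadj g m]
  have hT0 : T ≠ 0 := by
    intro h0
    have h1 : ⟪ψ, T ψ⟫_ℂ = 0 := by rw [h0]; simp
    rw [hTin] at h1
    have h2 : ∀ z, ⟪ρ z ψ, ψ⟫_ℂ * ⟪ψ, ρ z ψ⟫_ℂ = ((‖⟪ρ z ψ, ψ⟫_ℂ‖ ^ 2 : ℝ) : ℂ) := by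
      intro z
      rw [← inner_conj_symm ψ (ρ z ψ), RCLike.mul_conj]
      norm_cast
    simp only [h2] at h1
    rw [integral_complex_ofReal] at h1
    have h3 : 0 < ∫ z, ‖⟪ρ z ψ, ψ⟫_ℂ‖ ^ 2 ∂μ := by
      refine Continuous.integral_pos_of_hasCompactSupport_nonneg_nonzero (x := 1)
        (((hcont ψ).inner continuous_const).norm.pow 2) (HasCompactSupport.of_compactSpace _) ?_ ?_
      · intro z; positivity
      · simp [hψ]
    exact h3.ne' (by exact_mod_cast h1)
  obtain ⟨c, hc, hc0⟩ : ∃ c : ℂ, Module.End.HasEigenvalue (T : Module.End ℂ H) c ∧ c ≠ 0 := by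
    by_contra! hall
    exact hT0 ((ContinuousLinearMap.eq_zero_of_forall_hasEigenvalue_eq_zero hTcomp hTsymm).1 hall)
  refine ⟨Module.End.eigenspace (T : Module.End ℂ H) c,
    ContinuousLinearMap.finite_dimensional_eigenspace hTcomp c hc0, hc, ?_, ?_⟩
  · intro g w hw
    rw [Module.End.mem_eigenspace_iff] at hw ⊢
    change T (ρ g w) = _
    rw [hTρ]
    change T w = _ at hw
    rw [hw, map_smul]
  · intro m hm w hw
    rw [Module.End.mem_eigenspace_iff] at hw
    change T w = _ at hw
    have h1 := hTin m w
    simp only [hm, mul_zero, integral_zero, hw, inner_smul_right] at h1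
    exact (mul_eq_zero.1 h1).resolve_left hc0

omit [TopologicalSpace G] in
/-- A nonzero finite-dimensional invariant subspace contains an irreducible one. -/
theorem exists_irreducible_subspace (ρ : Representation ℂ G H) {W : Submodule ℂ H}
    [FiniteDimensional ℂ W] (hW0 : W ≠ ⊥) (hW : ∀ g, ∀ w ∈ W, ρ g w ∈ W) :
    ∃ W₀ ≤ W, W₀ ≠ ⊥ ∧ (∀ g, ∀ w ∈ W₀, ρ g w ∈ W₀) ∧
      ∀ W' ≤ W₀, (∀ g, ∀ w ∈ W', ρ g w ∈ W') → W' = ⊥ ∨ W' = W₀ := by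
  classical
  let p : ℕ → Prop := fun d => ∃ W₀ ≤ W, W₀ ≠ ⊥ ∧ (∀ g, ∀ w ∈ W₀, ρ g w ∈ W₀) ∧
    Module.finrank ℂ W₀ = d
  have hp : ∃ d, p d := ⟨_, W, le_rfl, hW0, hW, rfl⟩
  obtain ⟨W₀, hle, h0, hinv, hd⟩ := Nat.find_spec hp
  refine ⟨W₀, hle, h0, hinv, fun W' hW' hinv' => ?_⟩
  by_cases hb : W' = ⊥
  · exact Or.inl hb
  right
  have : FiniteDimensional ℂ W₀ := Submodule.finiteDimensional_of_le hle
  refine Submodule.eq_of_le_of_finrank_le hW' ?_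
  rw [hd]
  exact Nat.find_min' hp ⟨W', hW'.trans hle, hb, hinv', rfl⟩

/-- Every finite-dimensional irreducible unitary representation is unitarily equivalent to one on
`ℂ ^ d`. -/
theorem exists_unitaryIrrep {V : Type*} [NormedAddCommGroup V] [InnerProductSpace ℂ V]
    [FiniteDimensional ℂ V] (σ : Representation ℂ G V) (hσ : IsIrreducibleUnitary σ) :
    ∃ (π : UnitaryIrrep G) (e : V ≃ₗᵢ[ℂ] EuclideanSpace ℂ (Fin π.dim)),
      ∀ g v, π.rep g (e v) = e (σ g v) := by
  let e := (stdOrthonormalBasis ℂ V).repr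
  let ρ : Representation ℂ G (EuclideanSpace ℂ (Fin (Module.finrank ℂ V))) :=
    { toFun := fun g => e.toLinearEquiv.toLinearMap ∘ₗ σ g ∘ₗ e.symm.toLinearEquiv.toLinearMap
      map_one' := by ext1 v; simp
      map_mul' := fun g h => by ext1 v; simp }
  have hρ : ∀ g v, ρ g (e v) = e (σ g v) := fun g v => by simp [ρ]
  refine ⟨⟨_, ρ, ?_, ?_, ?_⟩, e, hρ⟩
  · intro v
    obtain ⟨v, rfl⟩ := e.surjective v
    simp only [hρ]
    exact e.continuous.comp (hσ.continuous v)
  · intro g v w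
    obtain ⟨v, rfl⟩ := e.surjective v
    obtain ⟨w, rfl⟩ := e.surjective w
    rw [hρ, hρ, e.inner_map_map, e.inner_map_map, hσ.unitary]
  · obtain ⟨hnt, hirr⟩ := (isIrreducible_iff σ).1 hσ.irreducible
    refine (isIrreducible_iff ρ).2 ⟨e.symm.toEquiv.nontrivial, fun W hW => ?_⟩
    have h1 := hirr (W.comap e.toLinearEquiv.toLinearMap) (fun g w hw => by
      simp only [Submodule.mem_comap] at hw ⊢
      have := hW g _ hw
      exact hρ g w ▸ this)
    rcases h1 with h1 | h1
    · left
      refine (Submodule.eq_bot_iff _).2 fun w hw => ?_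
      obtain ⟨w, rfl⟩ := e.surjective w
      have : w ∈ W.comap e.toLinearEquiv.toLinearMap := hw
      rw [h1, Submodule.mem_bot] at this
      simp [this]
    · right
      refine Submodule.eq_top_iff'.2 fun w => ?_
      obtain ⟨w, rfl⟩ := e.surjective w
      have : w ∈ W.comap e.toLinearEquiv.toLinearMap := h1 ▸ Submodule.mem_top
      exact this

end Invariant

section Coefficients

variable {G : Type*} [Group G] [TopologicalSpace G]

namespace UnitaryIrrep

variable (π : UnitaryIrrep G)

theorem rep_apply (g : G) (v : EuclideanSpace ℂ (Fin π.dim)) (i : Fin π.dim) :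
    π.rep g v i = ∑ j, π.matrix g i j * v j := by
  have h : v = ∑ j, v j • EuclideanSpace.single j (1 : ℂ) := by
    have := (EuclideanSpace.basisFun (Fin π.dim) ℂ).sum_repr v
    simpa using this.symm
  conv_lhs => rw [h, map_sum]
  simp [matrix, mul_comm]

theorem matrix_one : π.matrix 1 = 1 := by
  ext i j
  simp [matrix, Matrix.one_apply]

theorem matrix_mul (g h : G) : π.matrix (g * h) = π.matrix g * π.matrix h := by
  ext i j
  rw [Matrix.mul_apply]
  simp only [matrix, Matrix.of_apply, map_mul, Module.End.mul_apply]
  exact π.rep_apply g _ i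

theorem matrix_apply_eq_inner (g : G) (i j : Fin π.dim) : π.matrix g i j =
    ⟪EuclideanSpace.single i (1 : ℂ), π.rep g (EuclideanSpace.single j 1)⟫_ℂ := by
  simp [matrix, EuclideanSpace.inner_single_left]

theorem matrix_inv (g : G) : π.matrix g⁻¹ = (π.matrix g)ᴴ := by
  ext i j
  rw [Matrix.conjTranspose_apply, matrix_apply_eq_inner, matrix_apply_eq_inner,
    ← π.isIrreducibleUnitary.unitary g, ← Module.End.mul_apply, ← map_mul]
  simp

theorem matrix_mul_conjTranspose (g : G) : π.matrix g * (π.matrix g)ᴴ = 1 := by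
  rw [← matrix_inv, ← matrix_mul, mul_inv_cancel, matrix_one]

theorem continuous_matrix (i j : Fin π.dim) : Continuous fun g => π.matrix g i j :=
  (EuclideanSpace.proj (𝕜 := ℂ) i).continuous.comp (π.isIrreducibleUnitary.continuous _)

theorem dim_pos : 0 < π.dim := by
  have h := ((isIrreducible_iff π.rep).1 π.isIrreducibleUnitary.irreducible).1
  by_contra h0
  have : IsEmpty (Fin π.dim) := by
    rw [Nat.eq_zero_of_not_pos h0]; infer_instance
  exact not_nontrivial (EuclideanSpace ℂ (Fin π.dim)) h

/-- A matrix coefficient as a continuous function. -/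
noncomputable def coeff (i j : Fin π.dim) : C(G, ℂ) :=
  ⟨fun g => π.matrix g i j, π.continuous_matrix i j⟩

end UnitaryIrrep

section Schur

variable [IsTopologicalGroup G] [CompactSpace G] [MeasurableSpace G] [BorelSpace G]
  (μ : Measure G) [μ.IsHaarMeasure]

/-- The matrix `(∫ conj(π_{ij}) π'_{kl})_{jl}`. -/
noncomputable def schurMatrix (π π' : UnitaryIrrep G) (i : Fin π.dim) (k : Fin π'.dim) :
    Matrix (Fin π.dim) (Fin π'.dim) ℂ :=
  Matrix.of fun j l => ∫ z, star (π.matrix z i j) * π'.matrix z k l ∂μ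

theorem matrix_mul_schurMatrix (π π' : UnitaryIrrep G) (i : Fin π.dim) (k : Fin π'.dim) (g : G) :
    π.matrix g * schurMatrix μ π π' i k = schurMatrix μ π π' i k * π'.matrix g := by
  have := isMulRightInvariant_of_compactSpace μ
  have hint : ∀ j l, Integrable (fun z => star (π.matrix z i j) * π'.matrix z k l) μ :=
    fun j l => integrable_of_continuous μ
      ((continuous_star.comp (π.continuous_matrix i j)).mul (π'.continuous_matrix k l))
  ext j l
  simp only [Matrix.mul_apply, schurMatrix, Matrix.of_apply]
  simp only [← integral_const_mul, ← integral_mul_const]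
  rw [← integral_finsetSum _ (fun p _ => (hint p l).const_mul _),
    ← integral_finsetSum _ (fun p _ => (hint j p).mul_const _),
    ← integral_mul_right_eq_self (μ := μ) _ g]
  refine integral_congr_ae (Eventually.of_forall fun z => ?_)
  have h1 : star (π.matrix z i j) = ∑ p, π.matrix g j p * star (π.matrix (z * g) i p) := by
    have h2 : π.matrix z = π.matrix (z * g) * (π.matrix g)ᴴ := by
      rw [π.matrix_mul, mul_assoc, π.matrix_mul_conjTranspose, mul_one]
    conv_lhs => rw [h2, Matrix.mul_apply, star_sum]
    simp [mul_comm]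
  have h3 : π'.matrix (z * g) k l = ∑ p, π'.matrix z k p * π'.matrix g p l := by
    rw [π'.matrix_mul, Matrix.mul_apply]
  simp only [mul_assoc, ← Finset.mul_sum, ← h3]
  simp only [← mul_assoc, ← Finset.sum_mul, ← h1]

/-- The intertwining map with matrix `schurMatrix`. -/
noncomputable def schurMap (π π' : UnitaryIrrep G) (i : Fin π.dim) (k : Fin π'.dim) :
    Representation.IntertwiningMap π'.rep π.rep where
  toLinearMap := Matrix.toEuclideanLin (schurMatrix μ π π' i k)
  isIntertwining' := fun g => by
    ext1 v
    ext j
    have h : ∀ (ρ : UnitaryIrrep G) (w : EuclideanSpace ℂ (Fin ρ.dim)),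
        (ρ.rep g w).ofLp = ρ.matrix g *ᵥ w.ofLp := by
      intro ρ w; ext i; exact ρ.rep_apply g w i
    simp only [LinearMap.comp_apply, h, Matrix.ofLp_toLpLin, Matrix.toLin'_apply,
      Matrix.mulVec_mulVec, matrix_mul_schurMatrix]

theorem schurMatrix_eq_zero {π π' : UnitaryIrrep G} (h : π.toDual ≠ π'.toDual)
    (i : Fin π.dim) (k : Fin π'.dim) : schurMatrix μ π π' i k = 0 := by
  have := π.isIrreducibleUnitary.irreducible
  have := π'.isIrreducibleUnitary.irreducible
  rcases Representation.IsIrreducible.bijective_or_eq_zero (schurMap μ π π' i k) with hb | h0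
  · exfalso
    refine h (Quotient.sound ?_)
    exact ⟨(Representation.IntertwiningMap.ofBijective _ hb).symm⟩
  · have h1 := congrArg Representation.IntertwiningMap.toLinearMap h0
    exact (LinearEquiv.map_eq_zero_iff _).1 h1

theorem schurMatrix_self [IsProbabilityMeasure μ] (π : UnitaryIrrep G) (i k : Fin π.dim) :
    schurMatrix μ π π i k = (if i = k then (π.dim : ℂ)⁻¹ else 0) • 1 := by
  have := π.isIrreducibleUnitary.irreducible
  obtain ⟨c, hc⟩ :=
    (Representation.IsIrreducible.algebraMap_intertwiningMap_bijective_of_isAlgClosed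
      (k := ℂ) (ρ := π.rep)).2 (schurMap μ π π i k)
  have h1 : schurMatrix μ π π i k = c • 1 := by
    have h2 : (algebraMap ℂ (Representation.IntertwiningMap π.rep π.rep) c).toLinearMap =
        Matrix.toEuclideanLin (schurMatrix μ π π i k) :=
      congrArg Representation.IntertwiningMap.toLinearMap hc
    refine Matrix.toEuclideanLin.injective (h2.symm.trans ?_)
    rw [Algebra.algebraMap_eq_smul_one, map_smul]
    ext1 v
    have h3 : Matrix.toEuclideanLin (1 : Matrix (Fin π.dim) (Fin π.dim) ℂ) v = v := by
      ext j
      simp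
    rw [LinearMap.smul_apply, h3]
    rfl
  have h3 : (schurMatrix μ π π i k).trace = if i = k then 1 else 0 := by
    simp only [Matrix.trace, Matrix.diag, schurMatrix, Matrix.of_apply]
    have hint : ∀ p, Integrable (fun z => star (π.matrix z i p) * π.matrix z k p) μ :=
      fun p => integrable_of_continuous μ
        ((continuous_star.comp (π.continuous_matrix i p)).mul (π.continuous_matrix k p))
    rw [← integral_finsetSum _ (fun p _ => hint p)]
    have h4 : ∀ z, ∑ j, star (π.matrix z i j) * π.matrix z k j = if i = k then 1 else 0 := by
      intro z
      have := congrFun (congrFun (π.matrix_mul_conjTranspose z) k) i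
      rw [Matrix.mul_apply, Matrix.one_apply] at this
      simp only [Matrix.conjTranspose_apply] at this
      rw [if_congr eq_comm rfl rfl, ← this]
      exact Finset.sum_congr rfl fun j _ => mul_comm _ _
    simp only [h4]
    simp
  have hd : (π.dim : ℂ) ≠ 0 := by exact_mod_cast π.dim_pos.ne'
  rw [h1, Matrix.trace_smul, Matrix.trace_one, Fintype.card_fin, smul_eq_mul] at h3
  rw [h1]
  congr 1
  split_ifs at h3 ⊢ with hik
  · exact eq_inv_of_mul_eq_one_left h3
  · exact (mul_eq_zero.1 h3).resolve_right hd

end Schur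

end Coefficients

section Euclidean

variable {n : ℕ}

/-- Iterated partial derivatives; the head of the list is applied first. -/
noncomputable def partialDerivs : List (Fin n) → (EuclideanSpace ℝ (Fin n) → ℂ) →
    (EuclideanSpace ℝ (Fin n) → ℂ)
  | [], f => f
  | i :: I, f => partialDerivs I fun x => fderiv ℝ f x (EuclideanSpace.single i 1)

theorem contDiff_fderiv_apply_const {f : EuclideanSpace ℝ (Fin n) → ℂ} (hf : ContDiff ℝ ∞ f)
    (v : EuclideanSpace ℝ (Fin n)) : ContDiff ℝ ∞ fun x => fderiv ℝ f x v :=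
  (hf.fderiv_right (m := ∞) (by simp)).clm_apply contDiff_const

theorem contDiff_partialDerivs {f : EuclideanSpace ℝ (Fin n) → ℂ} (hf : ContDiff ℝ ∞ f)
    (I : List (Fin n)) : ContDiff ℝ ∞ (partialDerivs I f) := by
  induction I generalizing f with
  | nil => exact hf
  | cons i I ih => exact ih (contDiff_fderiv_apply_const hf _)

theorem partialDerivs_add {f g : EuclideanSpace ℝ (Fin n) → ℂ} (hf : ContDiff ℝ ∞ f)
    (hg : ContDiff ℝ ∞ g) (I : List (Fin n)) :
    partialDerivs I (fun x => f x + g x) = fun x => partialDerivs I f x + partialDerivs I g x := by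
  induction I generalizing f g with
  | nil => rfl
  | cons i I ih =>
    simp only [partialDerivs]
    rw [← ih (contDiff_fderiv_apply_const hf _) (contDiff_fderiv_apply_const hg _)]
    congr 1
    funext x
    rw [fderiv_fun_add (hf.differentiable (by simp) x) (hg.differentiable (by simp) x)]
    rfl

theorem partialDerivs_zero (I : List (Fin n)) :
    partialDerivs I (fun _ => (0 : ℂ)) = fun _ => 0 := by
  induction I with
  | nil => rfl
  | cons i I ih => simpa [partialDerivs] using ih

theorem partialDerivs_sum {ι : Type*} (s : Finset ι) {f : ι → EuclideanSpace ℝ (Fin n) → ℂ}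
    (hf : ∀ i, ContDiff ℝ ∞ (f i)) (I : List (Fin n)) :
    partialDerivs I (fun x => ∑ i ∈ s, f i x) = fun x => ∑ i ∈ s, partialDerivs I (f i) x := by
  classical
  induction s using Finset.induction_on with
  | empty => simpa using partialDerivs_zero I
  | insert a s ha ih =>
    simp only [Finset.sum_insert ha]
    rw [partialDerivs_add (hf a) (ContDiff.sum fun i _ => hf i), ih]

theorem enorm_le_lmarginal {f : EuclideanSpace ℝ (Fin n) → ℂ} (hf : ContDiff ℝ ∞ f)
    (hs : HasCompactSupport f) {I : List (Fin n)} (hI : I.Nodup) (x : Fin n → ℝ) :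
    ‖f (WithLp.toLp 2 x)‖ₑ ≤
      (∫⋯∫⁻_I.toFinset, (fun y => ‖partialDerivs I f (WithLp.toLp 2 y)‖ₑ) ∂fun _ => volume) x := by
  induction I generalizing f x with
  | nil => simp [partialDerivs]
  | cons i I ih =>
    obtain ⟨hi, hI'⟩ := List.nodup_cons.1 hI
    have hcont : Continuous (partialDerivs (i :: I) f) := (contDiff_partialDerivs hf _).continuous
    have hmeas : Measurable fun y : Fin n → ℝ => ‖partialDerivs (i :: I) f (WithLp.toLp 2 y)‖ₑ :=
      (hcont.comp (PiLp.continuous_toLp 2 _)).enorm.measurable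
    rw [List.toFinset_cons, lmarginal_insert _ hmeas (by simpa using hi)]
    have hline : ∀ t, HasDerivAt (fun t => f (WithLp.toLp 2 (Function.update x i t)))
        (fderiv ℝ f (WithLp.toLp 2 (Function.update x i t)) (EuclideanSpace.single i 1)) t := by
      intro t
      have h1 := ((PiLp.continuousLinearEquiv 2 ℝ fun _ : Fin n => ℝ).symm
        : (Fin n → ℝ) →L[ℝ] EuclideanSpace ℝ (Fin n)).hasFDerivAt.comp_hasDerivAt t
        (hasDerivAt_update x i t)
      have h2 := (hf.differentiable (by simp)
        (WithLp.toLp 2 (Function.update x i t))).hasFDerivAt.comp_hasDerivAt t h1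
      exact h2
    calc ‖f (WithLp.toLp 2 x)‖ₑ
        = ‖f (WithLp.toLp 2 (Function.update x i (x i)))‖ₑ := by rw [Function.update_eq_self]
      _ ≤ ∫⁻ t in Set.Iic (x i),
          ‖deriv (fun t => f (WithLp.toLp 2 (Function.update x i t))) t‖ₑ := by
        refine HasCompactSupport.enorm_le_lintegral_Ici_deriv
          (f := fun t => f (WithLp.toLp 2 (Function.update x i t))) ?_ ?_ (x i)
        · refine (hf.of_le (by simp)).comp ?_
          exact (PiLp.continuousLinearEquiv 2 ℝ fun _ : Fin n => ℝ).symm.contDiff.comp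
            (contDiff_update 1 x i)
        · exact (hs.comp_homeomorph (PiLp.homeomorph 2 fun _ : Fin n => ℝ).symm
            ).comp_isClosedEmbedding (isClosedEmbedding_update x i)
      _ ≤ ∫⁻ t, ‖deriv (fun t => f (WithLp.toLp 2 (Function.update x i t))) t‖ₑ :=
        lintegral_mono' Measure.restrict_le_self le_rfl
      _ ≤ _ := by
        refine lintegral_mono fun t => ?_
        rw [(hline t).deriv]
        exact ih (contDiff_fderiv_apply_const hf _) (hs.fderiv_apply ℝ _) hI' _

/-- A smooth compactly supported function is bounded by the `L¹` norm of its mixed derivative. -/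
theorem enorm_le_lintegral_partialDerivs {f : EuclideanSpace ℝ (Fin n) → ℂ} (hf : ContDiff ℝ ∞ f)
    (hs : HasCompactSupport f) (x : EuclideanSpace ℝ (Fin n)) :
    ‖f x‖ₑ ≤ ∫⁻ y, ‖partialDerivs (List.finRange n) f y‖ₑ := by
  have h := enorm_le_lmarginal hf hs (List.nodup_finRange n) x.ofLp
  rw [List.toFinset_finRange, lmarginal_univ] at h
  refine h.trans_eq ?_
  exact (PiLp.volume_preserving_toLp (Fin n)).lintegral_comp_emb
    (MeasurableEquiv.toLp 2 (Fin n → ℝ)).measurableEmbedding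
    fun y => ‖partialDerivs (List.finRange n) f y‖ₑ

end Euclidean

section Chart

variable {n : ℕ} {G : Type*} [Group G] [TopologicalSpace G]
  [ChartedSpace (EuclideanSpace ℝ (Fin n)) G] [LieGroup (𝓡 n) ∞ G]

/-- In the chart at `1`, constant vector fields are combinations of the left-invariant ones with
smooth coefficients. -/
theorem exists_fderiv_comp_chart_symm :
    ∃ a : EuclideanSpace ℝ (Fin n) → EuclideanSpace ℝ (Fin n) →L[ℝ] EuclideanSpace ℝ (Fin n),
      ContDiffOn ℝ ∞ a (chartAt (EuclideanSpace ℝ (Fin n)) (1 : G)).target ∧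
      ∀ u : G → ℂ, ContMDiff (𝓡 n) 𝓘(ℝ, ℂ) ∞ u →
        ∀ x ∈ (chartAt (EuclideanSpace ℝ (Fin n)) (1 : G)).target, ∀ v,
        fderiv ℝ (fun y => u ((chartAt (EuclideanSpace ℝ (Fin n)) (1 : G)).symm y)) x v =
          vecDeriv (a x v) u ((chartAt (EuclideanSpace ℝ (Fin n)) (1 : G)).symm x) := by
  have hG : IsTopologicalGroup G := topologicalGroup_of_lieGroup (𝓡 n) ∞
  have hG1 : IsManifold (𝓡 n) ∞ G := inferInstance
  set e := chartAt (EuclideanSpace ℝ (Fin n)) (1 : G) with he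
  have h1e : (1 : G) ∈ e.source := mem_chart_source _ _
  have hes : ContMDiffOn (𝓡 n) (𝓡 n) ∞ e e.source := contMDiffOn_chart
  have het : ContMDiffOn (𝓡 n) (𝓡 n) ∞ e.symm e.target := contMDiffOn_chart_symm
  let H : EuclideanSpace ℝ (Fin n) × EuclideanSpace ℝ (Fin n) → G :=
    fun p => (e.symm p.1)⁻¹ * e.symm p.2
  have hH : ContMDiffOn (𝓘(ℝ, EuclideanSpace ℝ (Fin n) × EuclideanSpace ℝ (Fin n))) (𝓡 n) ∞ H
      (e.target ×ˢ e.target) := by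
    rw [modelWithCornersSelf_prod, ← chartedSpaceSelf_prod]
    exact (het.comp contMDiffOn_fst (fun p hp => hp.1)).inv.mul
      (het.comp contMDiffOn_snd (fun p hp => hp.2))
  let Ω : Set (EuclideanSpace ℝ (Fin n) × EuclideanSpace ℝ (Fin n)) :=
    (e.target ×ˢ e.target) ∩ H ⁻¹' e.source
  have hΩ : IsOpen Ω :=
    hH.continuousOn.isOpen_inter_preimage (e.open_target.prod e.open_target) e.open_source
  let F : EuclideanSpace ℝ (Fin n) × EuclideanSpace ℝ (Fin n) → EuclideanSpace ℝ (Fin n) :=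
    fun p => e (H p)
  have hF : ContDiffOn ℝ ∞ F Ω :=
    contMDiffOn_iff_contDiffOn.1
      (hes.comp (hH.mono Set.inter_subset_left) (fun p hp => hp.2))
  have hdiag : ∀ x ∈ e.target, (x, x) ∈ Ω := fun x hx => ⟨⟨hx, hx⟩, by simpa [H] using h1e⟩
  let D : EuclideanSpace ℝ (Fin n) →L[ℝ] EuclideanSpace ℝ (Fin n) :=
    modelDeriv (𝓡 n) (𝓡 n) e.symm (e 1)
  refine ⟨fun x => D ∘L (fderiv ℝ F (x, x) ∘L ContinuousLinearMap.inr ℝ _ _), ?_, ?_⟩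
  · have h1 : ContDiffOn ℝ ∞ (fun x => fderiv ℝ F (x, x)) e.target :=
      (hF.fderiv_of_isOpen (m := ∞) hΩ (by simp)).comp
        (contDiff_id.prodMk contDiff_id).contDiffOn hdiag
    exact contDiffOn_const.clm_comp (h1.clm_comp contDiffOn_const)
  · intro u hu x hx v
    have hFx : HasFDerivAt (fun y => F (x, y))
        (fderiv ℝ F (x, x) ∘L ContinuousLinearMap.inr ℝ _ _) x := by
      have h1 : HasFDerivAt F (fderiv ℝ F (x, x)) (x, x) :=
        ((hF.contDiffAt (hΩ.mem_nhds (hdiag x hx))).differentiableAt (by simp)).hasFDerivAt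
      exact h1.comp x (hasFDerivAt_prodMk_right x x)
    have hF0 : F (x, x) = e 1 := by simp [F, H]
    have hw : ContMDiff (𝓡 n) 𝓘(ℝ, ℂ) ∞ (fun z => u (e.symm x * z)) :=
      hu.comp contMDiff_mul_left
    have hes1 : MDifferentiableAt (𝓡 n) (𝓡 n) e.symm (e 1) :=
      (het.contMDiffAt (e.open_target.mem_nhds (e.map_source h1e))).mdifferentiableAt (by simp)
    have hw1 : HasFDerivAt (fun y => u (e.symm x * e.symm y))
        (modelDeriv (𝓡 n) 𝓘(ℝ, ℂ) (fun z => u (e.symm x * z)) 1 ∘L D) (e 1) := by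
      have h1 : e.symm (e 1) = 1 := e.left_inv h1e
      have h2 : HasMFDerivAt (𝓡 n) 𝓘(ℝ, ℂ) (fun z => u (e.symm x * z)) (e.symm (e 1))
          (modelDeriv (𝓡 n) 𝓘(ℝ, ℂ) (fun z => u (e.symm x * z)) 1) := by
        rw [h1]
        exact (hw.mdifferentiableAt (by simp)).hasMFDerivAt
      exact (h2.comp (e 1) hes1.hasMFDerivAt).hasFDerivAt
    rw [← hF0] at hw1
    have hcomp := hw1.comp x hFx
    have hev : (fun y => u (e.symm y)) =ᶠ[𝓝 x]
        (fun y => u (e.symm x * e.symm y)) ∘ (fun y => F (x, y)) := by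
      have hop : ∀ᶠ y in 𝓝 x, (x, y) ∈ Ω :=
        (Continuous.prodMk_right x).continuousAt.eventually (hΩ.mem_nhds (hdiag x hx))
      filter_upwards [hop] with y hy
      simp only [Function.comp_apply, F]
      rw [e.left_inv hy.2]
      simp [H]
    rw [(hcomp.congr_of_eventuallyEq hev).fderiv]
    exact (leftInvDeriv_eq hu _ _).symm

omit [LieGroup (𝓡 n) ∞ G] [Group G] [TopologicalSpace G]
  [ChartedSpace (EuclideanSpace ℝ (Fin n)) G] in
theorem contDiff_of_tsupport {E V : Type*} [NormedAddCommGroup E] [NormedSpace ℝ E]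
    [NormedAddCommGroup V] [NormedSpace ℝ V] {f : E → V}
    (hf : ∀ x ∈ tsupport f, ContDiffAt ℝ ∞ f x) : ContDiff ℝ ∞ f :=
  contMDiff_iff_contDiff.1 (contMDiff_of_tsupport fun x hx => (hf x hx).contMDiffAt)

theorem contDiff_smul_comp_chart_symm {b : EuclideanSpace ℝ (Fin n) → ℝ} (hb : ContDiff ℝ ∞ b)
    (hbs : tsupport b ⊆ (chartAt (EuclideanSpace ℝ (Fin n)) (1 : G)).target)
    {u : G → ℂ} (hu : ContMDiff (𝓡 n) 𝓘(ℝ, ℂ) ∞ u) :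
    ContDiff ℝ ∞ (fun x => b x • u ((chartAt (EuclideanSpace ℝ (Fin n)) (1 : G)).symm x)) := by
  have hG1 : IsManifold (𝓡 n) ∞ G := inferInstance
  refine contDiff_of_tsupport fun x hx => ?_
  have hx' := hbs (tsupport_smul_subset_left _ _ hx)
  have h1 : ContMDiffOn (𝓡 n) (𝓡 n) ∞ (chartAt (EuclideanSpace ℝ (Fin n)) (1 : G)).symm
    (chartAt (EuclideanSpace ℝ (Fin n)) (1 : G)).target := contMDiffOn_chart_symm
  exact hb.contDiffAt.smul (contMDiffAt_iff_contDiffAt.1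
    (hu.contMDiffAt.comp x
      (h1.contMDiffAt ((chartAt _ (1 : G)).open_target.mem_nhds hx'))))

theorem exists_norm_partialDerivs_le (I : List (Fin n)) {b : EuclideanSpace ℝ (Fin n) → ℝ}
    (hb : ContDiff ℝ ∞ b) (hbc : HasCompactSupport b)
    (hbs : tsupport b ⊆ (chartAt (EuclideanSpace ℝ (Fin n)) (1 : G)).target) :
    ∃ C : ℝ, 0 ≤ C ∧ ∀ u : G → ℂ, ContMDiff (𝓡 n) 𝓘(ℝ, ℂ) ∞ u → ∀ x ε,
      (∀ J : List (Fin n), J.length ≤ I.length →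
        ‖iterVecDeriv (J.map fun j => EuclideanSpace.single j (1 : ℝ)) u
          ((chartAt (EuclideanSpace ℝ (Fin n)) (1 : G)).symm x)‖ ≤ ε) →
      ‖partialDerivs I (fun x => b x •
        u ((chartAt (EuclideanSpace ℝ (Fin n)) (1 : G)).symm x)) x‖ ≤ C * ε := by
  induction I generalizing b with
  | nil =>
    obtain ⟨C, hC⟩ := hbc.exists_bound_of_continuous hb.continuous
    refine ⟨max C 0, le_max_right _ _, fun u hu x ε h => ?_⟩
    simp only [partialDerivs, norm_smul]
    have := h [] le_rfl
    simp only [List.map_nil, iterVecDeriv_nil] at this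
    gcongr
    exact (hC x).trans (le_max_left _ _)
  | cons i I ih =>
    obtain ⟨a, ha, haf⟩ := exists_fderiv_comp_chart_symm (n := n) (G := G)
    set e := chartAt (EuclideanSpace ℝ (Fin n)) (1 : G) with he
    let b₀ : EuclideanSpace ℝ (Fin n) → ℝ := fun x => fderiv ℝ b x (EuclideanSpace.single i 1)
    let c : Fin n → EuclideanSpace ℝ (Fin n) → ℝ :=
      fun j x => b x * a x (EuclideanSpace.single i 1) j
    have hb₀ : ContDiff ℝ ∞ b₀ := (hb.fderiv_right (m := ∞) (by simp)).clm_apply contDiff_const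
    have hb₀s : tsupport b₀ ⊆ tsupport b := tsupport_fderiv_apply_subset ℝ _
    have hcs : ∀ j, tsupport (c j) ⊆ tsupport b := fun j => tsupport_mul_subset_left
    have hc : ∀ j, ContDiff ℝ ∞ (c j) := by
      intro j
      refine contDiff_of_tsupport fun x hx => hb.contDiffAt.mul ?_
      have h1 := (ha.contDiffAt (e.open_target.mem_nhds (hbs (hcs j hx)))).clm_apply
        (contDiffAt_const (c := EuclideanSpace.single i (1 : ℝ)))
      exact (EuclideanSpace.proj (𝕜 := ℝ) j).contDiff.contDiffAt.comp x h1
    obtain ⟨C₀, hC₀, h₀⟩ := ih hb₀ (hbc.mono' (subset_closure.trans hb₀s)) (hb₀s.trans hbs)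
    choose C hC h using fun j => ih (hc j) (hbc.mono' (subset_closure.trans (hcs j)))
      ((hcs j).trans hbs)
    refine ⟨C₀ + ∑ j, C j, add_nonneg hC₀ (Finset.sum_nonneg fun j _ => hC j),
      fun u hu x ε hε => ?_⟩
    have hkey : (fun x => fderiv ℝ (fun x => b x • u (e.symm x)) x (EuclideanSpace.single i 1)) =
        fun x => b₀ x • u (e.symm x) +
          ∑ j, c j x • vecDeriv (EuclideanSpace.single j (1 : ℝ)) u (e.symm x) := by
      funext x
      by_cases hx : x ∈ tsupport b
      · have hxt := hbs hx
        have hd : DifferentiableAt ℝ (fun y => u (e.symm y)) x := by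
          have hG1 : IsManifold (𝓡 n) ∞ G := inferInstance
          have h1 : ContMDiffOn (𝓡 n) (𝓡 n) ∞ e.symm e.target := contMDiffOn_chart_symm
          exact (contMDiffAt_iff_contDiffAt.1 (hu.contMDiffAt.comp x
            (h1.contMDiffAt (e.open_target.mem_nhds hxt)))).differentiableAt (by simp)
        have h2 := ((hb.differentiable (by simp) x).hasFDerivAt.smul hd.hasFDerivAt).fderiv
        rw [show (fun x => b x • u (e.symm x)) = b • (fun y => u (e.symm y)) from rfl, h2]
        simp only [add_apply, smul_apply,
          ContinuousLinearMap.smulRight_apply]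
        rw [haf u hu x hxt, vecDeriv_eq_sum hu, add_comm]
        congr 1
        simp only [Finset.sum_apply, Pi.smul_apply, Finset.smul_sum, Complex.coe_smul, c, mul_smul]
      · have h1 : b =ᶠ[𝓝 x] 0 := notMem_tsupport_iff_eventuallyEq.1 hx
        have h2 : (fun x => b x • u (e.symm x)) =ᶠ[𝓝 x] fun _ => 0 := by
          filter_upwards [h1] with y hy
          simp [hy]
        have h3 : b₀ x = 0 := by
          by_contra h0
          exact hx (hb₀s (subset_closure h0))
        rw [h2.fderiv_eq, h3]
        simp [c, h1.eq_of_nhds]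
    have hXu : ∀ j, ContMDiff (𝓡 n) 𝓘(ℝ, ℂ) ∞
        (vecDeriv (EuclideanSpace.single j (1 : ℝ)) u) := fun j => contMDiff_vecDeriv hu _
    have hs1 := contDiff_smul_comp_chart_symm hb₀ (hb₀s.trans hbs) hu
    have hs2 := fun j => contDiff_smul_comp_chart_symm (hc j) ((hcs j).trans hbs) (hXu j)
    have hexp : partialDerivs (i :: I) (fun x => b x • u (e.symm x)) = fun x =>
        partialDerivs I (fun x => b₀ x • u (e.symm x)) x + ∑ j, partialDerivs I (fun x => c j x •
          vecDeriv (EuclideanSpace.single j (1 : ℝ)) u (e.symm x)) x := by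
      change partialDerivs I (fun x => fderiv ℝ (fun x => b x • u (e.symm x)) x
        (EuclideanSpace.single i 1)) = _
      rw [hkey, partialDerivs_add hs1 (ContDiff.sum fun j _ => hs2 j), partialDerivs_sum _ hs2]
    rw [hexp, add_mul, Finset.sum_mul]
    refine (norm_add_le _ _).trans (add_le_add ?_ ((norm_sum_le _ _).trans
      (Finset.sum_le_sum fun j _ => ?_)))
    · exact h₀ u hu x ε fun J hJ => hε J (hJ.trans (Nat.le_succ _))
    · refine h j _ (hXu j) x ε fun J hJ => ?_
      have := hε (J ++ [j]) (by simpa using hJ)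
      rwa [List.map_append, iterVecDeriv_append] at this

end Chart

section Sobolev

variable {n : ℕ} {G : Type*} [Group G] [TopologicalSpace G]
  [ChartedSpace (EuclideanSpace ℝ (Fin n)) G] [LieGroup (𝓡 n) ∞ G]

omit [Group G] [TopologicalSpace G] [ChartedSpace (EuclideanSpace ℝ (Fin n)) G]
  [LieGroup (𝓡 n) ∞ G] in
theorem tsupport_partialDerivs_subset (I : List (Fin n)) (f : EuclideanSpace ℝ (Fin n) → ℂ) :
    tsupport (partialDerivs I f) ⊆ tsupport f := by
  induction I generalizing f with
  | nil => exact subset_rfl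
  | cons i I ih => exact (ih _).trans (tsupport_fderiv_apply_subset ℝ _)

variable (n G) in
/-- Near the identity, a smooth function is bounded by the integral of its derivatives over a
compact subset of the chart. -/
theorem exists_local_sobolev :
    ∃ (B : Set (EuclideanSpace ℝ (Fin n))) (S : Finset (List (EuclideanSpace ℝ (Fin n)))) (C : ℝ),
      IsCompact B ∧ B ⊆ (chartAt (EuclideanSpace ℝ (Fin n)) (1 : G)).target ∧ 0 ≤ C ∧
      ∀ᶠ g in 𝓝 (1 : G), ∀ w : G → ℂ, ContMDiff (𝓡 n) 𝓘(ℝ, ℂ) ∞ w →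
        ‖w g‖ₑ ≤ ∫⁻ x in B, ENNReal.ofReal (C * ∑ L ∈ S, ‖iterVecDeriv L w
          ((chartAt (EuclideanSpace ℝ (Fin n)) (1 : G)).symm x)‖) := by
  classical
  set e := chartAt (EuclideanSpace ℝ (Fin n)) (1 : G) with he
  have h1e : (1 : G) ∈ e.source := mem_chart_source _ _
  obtain ⟨b, hbs, hbc, hb, -, hb1⟩ := exists_contDiff_tsupport_subset (n := ⊤)
    (e.open_target.mem_nhds (e.map_source h1e))
  obtain ⟨C, hC, hder⟩ := exists_norm_partialDerivs_le (G := G) (List.finRange n) hb hbc hbs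
  have hfin : ((fun J : List (Fin n) => J.map fun j => EuclideanSpace.single j (1 : ℝ)) ''
      {J | J.length ≤ n}).Finite := (List.finite_length_le (Fin n) n).image _
  refine ⟨tsupport b, hfin.toFinset, 2 * C, hbc, hbs, by positivity, ?_⟩
  have hbe : ContinuousAt (fun g => b (e g)) 1 :=
    ContinuousAt.comp hb.continuous.continuousAt (e.continuousAt h1e)
  filter_upwards [e.open_source.mem_nhds h1e,
    hbe.eventually (lt_mem_nhds (show (1 / 2 : ℝ) < b (e 1) by rw [hb1]; norm_num))] with g hg hbg
  intro w hw
  have hcs : HasCompactSupport fun x => b x • w (e.symm x) := hbc.smul_right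
  have h1 := enorm_le_lintegral_partialDerivs (contDiff_smul_comp_chart_symm hb hbs hw) hcs (e g)
  have h0 : ‖w g‖ₑ ≤ ENNReal.ofReal 2 * ‖b (e g) • w (e.symm (e g))‖ₑ := by
    rw [e.left_inv hg, ← ofReal_norm, ← ofReal_norm, norm_smul, Real.norm_of_nonneg (by linarith),
      ← ENNReal.ofReal_mul (by norm_num)]
    refine ENNReal.ofReal_le_ofReal ?_
    nlinarith [norm_nonneg (w g)]
  refine h0.trans ((mul_le_mul_right h1 _).trans ?_)
  have hsupp : ∫⁻ y, ‖partialDerivs (List.finRange n) (fun x => b x • w (e.symm x)) y‖ₑ =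
      ∫⁻ y in tsupport b,
        ‖partialDerivs (List.finRange n) (fun x => b x • w (e.symm x)) y‖ₑ := by
    rw [← lintegral_indicator (isClosed_tsupport b).measurableSet]
    congr 1
    funext y
    by_cases hy : y ∈ tsupport b
    · rw [Set.indicator_of_mem hy]
    · rw [Set.indicator_of_notMem hy, enorm_eq_zero]
      by_contra hne
      exact hy (tsupport_smul_subset_left _ _
        (tsupport_partialDerivs_subset _ _ (subset_closure hne)))
  rw [hsupp, ← lintegral_const_mul' _ _ (by simp)]
  refine lintegral_mono fun y => ?_
  rw [← ofReal_norm, ← ENNReal.ofReal_mul (by norm_num), mul_assoc]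
  refine ENNReal.ofReal_le_ofReal (mul_le_mul_of_nonneg_left ?_ (by norm_num))
  refine hder w hw y _ fun J hJ => ?_
  exact Finset.single_le_sum (f := fun L => ‖iterVecDeriv L w (e.symm y)‖)
    (fun L _ => norm_nonneg _) (hfin.mem_toFinset.2 ⟨J, by simpa using hJ, rfl⟩)

/-- A Sobolev inequality: the supremum norm is bounded by the `L¹` norms of finitely many
left-invariant derivatives. -/
theorem exists_sobolev [CompactSpace G] [MeasurableSpace G] [BorelSpace G] (μ : Measure G)
    [μ.IsHaarMeasure] [IsProbabilityMeasure μ] :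
    ∃ (S : Finset (List (EuclideanSpace ℝ (Fin n)))) (C : ℝ), 0 ≤ C ∧
      ∀ w : G → ℂ, ContMDiff (𝓡 n) 𝓘(ℝ, ℂ) ∞ w → ∀ x,
        ‖w x‖ ≤ C * ∑ L ∈ S, ∫ y, ‖iterVecDeriv L w y‖ ∂μ := by
  have hG : IsTopologicalGroup G := topologicalGroup_of_lieGroup (𝓡 n) ∞
  have hμ := isMulRightInvariant_of_compactSpace μ
  obtain ⟨B, S, C, hB, hBt, hC, hloc⟩ := exists_local_sobolev n G
  set e := chartAt (EuclideanSpace ℝ (Fin n)) (1 : G) with he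
  obtain ⟨V, hV, hVo, hV1⟩ := eventually_nhds_iff.1
    ((tendsto_inv (1 : G)).eventually (by rw [inv_one]; exact hloc))
  have hμV : μ V ≠ 0 := (hVo.measure_pos μ ⟨1, hV1⟩).ne'
  refine ⟨S, (volume B).toReal * C / (μ V).toReal, by positivity, ?_⟩
  have hone : ∀ w : G → ℂ, ContMDiff (𝓡 n) 𝓘(ℝ, ℂ) ∞ w →
      ‖w 1‖ ≤ (volume B).toReal * C / (μ V).toReal * ∑ L ∈ S, ∫ y, ‖iterVecDeriv L w y‖ ∂μ := by
    intro w hw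
    let q : G → ℝ := fun g => C * ∑ L ∈ S, ‖iterVecDeriv L w g‖
    have hq : Continuous q := continuous_const.mul
      (continuous_finsetSum _ fun L _ => (contMDiff_iterVecDeriv hw L).continuous.norm)
    have hq0 : ∀ g, 0 ≤ q g := fun g => mul_nonneg hC (Finset.sum_nonneg fun L _ => norm_nonneg _)
    have hg : ∀ g ∈ V, ‖w 1‖ₑ ≤ ∫⁻ x in B, ENNReal.ofReal (q (g * e.symm x)) := by
      intro g hgV
      have h1 := hV g hgV (fun z => w (g * z)) (hw.comp contMDiff_mul_left)
      simp only [mul_inv_cancel] at h1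
      refine h1.trans_eq ?_
      have h2 : ∀ L, iterVecDeriv L (fun z => w (g * z)) = fun z => iterVecDeriv L w (g * z) :=
        fun L => iterLeftInvDeriv_mul_left hw g L
      simp only [h2, q]
    have hmeas : AEMeasurable (Function.uncurry fun g x => ENNReal.ofReal (q (g * e.symm x)))
        (μ.prod (volume.restrict B)) := by
      have h1 : ContinuousOn (Function.uncurry fun g x => ENNReal.ofReal (q (g * e.symm x)))
          (Set.univ ×ˢ B) := by
        refine ENNReal.continuous_ofReal.comp_continuousOn (hq.comp_continuousOn ?_)
        exact continuousOn_fst.mul ((e.symm.continuousOn.mono hBt).comp continuousOn_snd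
          fun p hp => hp.2)
      have h2 := h1.aemeasurable (μ := μ.prod volume) (MeasurableSet.univ.prod hB.measurableSet)
      rwa [← Measure.prod_restrict, Measure.restrict_univ] at h2
    have hmain : μ V * ‖w 1‖ₑ ≤ volume B * ENNReal.ofReal (∫ g, q g ∂μ) := by
      calc μ V * ‖w 1‖ₑ = ∫⁻ _ in V, ‖w 1‖ₑ ∂μ := by rw [setLIntegral_const, mul_comm]
        _ ≤ ∫⁻ g in V, (∫⁻ x in B, ENNReal.ofReal (q (g * e.symm x))) ∂μ :=
          setLIntegral_mono' hVo.measurableSet hg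
        _ ≤ ∫⁻ g, (∫⁻ x in B, ENNReal.ofReal (q (g * e.symm x))) ∂μ :=
          lintegral_mono' Measure.restrict_le_self le_rfl
        _ = ∫⁻ x in B, (∫⁻ g, ENNReal.ofReal (q (g * e.symm x)) ∂μ) :=
          lintegral_lintegral_swap hmeas
        _ = ∫⁻ _ in B, (∫⁻ g, ENNReal.ofReal (q g) ∂μ) := by
          congr 1
          funext x
          exact lintegral_mul_right_eq_self (fun g => ENNReal.ofReal (q g)) _
        _ = volume B * ENNReal.ofReal (∫ g, q g ∂μ) := by
          rw [setLIntegral_const, mul_comm, ofReal_integral_eq_lintegral_ofReal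
            (integrable_of_continuous μ hq) (Eventually.of_forall hq0)]
    have hqi : ∫ g, q g ∂μ = C * ∑ L ∈ S, ∫ y, ‖iterVecDeriv L w y‖ ∂μ := by
      rw [integral_const_mul, integral_finsetSum _ fun L _ => integrable_of_continuous μ
        (contMDiff_iterVecDeriv hw L).continuous.norm]
    have hfin := ENNReal.toReal_mono (ENNReal.mul_ne_top hB.measure_lt_top.ne ENNReal.ofReal_ne_top)
      hmain
    rw [ENNReal.toReal_mul, ENNReal.toReal_mul, toReal_enorm,
      ENNReal.toReal_ofReal (integral_nonneg hq0), hqi] at hfin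
    have hpos : 0 < (μ V).toReal := ENNReal.toReal_pos hμV (measure_ne_top μ V)
    rw [div_mul_eq_mul_div, le_div_iff₀ hpos]
    linarith
  intro w hw x
  have h1 := hone (fun z => w (x * z)) (hw.comp contMDiff_mul_left)
  have h2 : ∀ L, iterVecDeriv L (fun z => w (x * z)) = fun z => iterVecDeriv L w (x * z) :=
    fun L => iterLeftInvDeriv_mul_left hw x L
  simp only [h2, mul_one] at h1
  refine h1.trans_eq ?_
  congr 1
  exact Finset.sum_congr rfl fun L _ =>
    integral_mul_left_eq_self (fun y => ‖iterVecDeriv L w y‖) x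

end Sobolev

section PeterWeyl

variable {G : Type*} [Group G] [TopologicalSpace G] [IsTopologicalGroup G] [CompactSpace G]
  [MeasurableSpace G] [BorelSpace G] (μ : Measure G) [μ.IsHaarMeasure]

theorem measurePreserving_mul_right_of_compactSpace (g : G) : MeasurePreserving (· * g) μ μ :=
  have := isMulRightInvariant_of_compactSpace μ
  measurePreserving_mul_right μ g

/-- The right regular representation on `L²(G)`. -/
noncomputable def rightRegular : Representation ℂ G (Lp ℂ 2 μ) where
  toFun g := (Lp.compMeasurePreservingₗᵢ ℂ (· * g)
    (measurePreserving_mul_right_of_compactSpace μ g)).toLinearMap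
  map_one' := by
    ext1 f
    refine Lp.ext ((Lp.coeFn_compMeasurePreserving f
      (measurePreserving_mul_right_of_compactSpace μ 1)).trans (Eventually.of_forall fun x => ?_))
    simp
  map_mul' g h := by
    ext1 f
    have h1 := Lp.coeFn_compMeasurePreserving f (measurePreserving_mul_right_of_compactSpace μ h)
    have hg := measurePreserving_mul_right_of_compactSpace μ g
    refine Lp.ext ((Lp.coeFn_compMeasurePreserving f
      (measurePreserving_mul_right_of_compactSpace μ (g * h))).trans ?_)
    refine EventuallyEq.trans ?_ (Lp.coeFn_compMeasurePreserving _ hg).symm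
    filter_upwards [hg.quasiMeasurePreserving.ae h1] with x hx
    simp only [Function.comp_apply] at hx ⊢
    exact (congrArg f (mul_assoc x g h).symm).trans hx.symm

theorem coeFn_rightRegular (g : G) (f : Lp ℂ 2 μ) :
    rightRegular μ g f =ᵐ[μ] fun x => f (x * g) :=
  Lp.coeFn_compMeasurePreserving f (measurePreserving_mul_right_of_compactSpace μ g)

theorem inner_rightRegular (g : G) (f f' : Lp ℂ 2 μ) :
    ⟪rightRegular μ g f, rightRegular μ g f'⟫_ℂ = ⟪f, f'⟫_ℂ :=
  (Lp.compMeasurePreservingₗᵢ ℂ (· * g)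
    (measurePreserving_mul_right_of_compactSpace μ g)).inner_map_map f f'

theorem continuous_rightRegular [T2Space G] [SecondCountableTopology G] (f : Lp ℂ 2 μ) :
    Continuous fun g => rightRegular μ g f := by
  have hc : Continuous fun g : G => (⟨fun x => x * g, continuous_mul_const g⟩ : C(G, G)) :=
    ContinuousMap.continuous_of_continuous_uncurry _ (by
      change Continuous fun p : G × G => p.2 * p.1
      fun_prop)
  exact (continuous_const (y := f)).compMeasurePreservingLp hc
    (fun g => measurePreserving_mul_right_of_compactSpace μ g) (by simp)

/-- A matrix coefficient as an element of `L²(G)`. -/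
noncomputable def UnitaryIrrep.coeffLp (π : UnitaryIrrep G) (i j : Fin π.dim) : Lp ℂ 2 μ :=
  ContinuousMap.toLp 2 μ ℂ (π.coeff i j)

omit [IsTopologicalGroup G] in
theorem UnitaryIrrep.coeFn_coeffLp (π : UnitaryIrrep G) (i j : Fin π.dim) :
    π.coeffLp μ i j =ᵐ[μ] fun x => π.matrix x i j :=
  ContinuousMap.coeFn_toLp μ _

omit [Group G] [TopologicalSpace G] [IsTopologicalGroup G] [CompactSpace G] [BorelSpace G]
  [μ.IsHaarMeasure] in
theorem coeFn_sum_smul {ι : Type*} [Fintype ι] (c : ι → ℂ) (f : ι → Lp ℂ 2 μ) :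
    (∑ i, c i • f i : Lp ℂ 2 μ) =ᵐ[μ] fun x => ∑ i, c i * f i x := by
  have h1 : ∀ᵐ x ∂μ, ∀ i, (c i • f i : Lp ℂ 2 μ) x = c i * f i x :=
    ae_all_iff.2 fun i => by
      filter_upwards [Lp.coeFn_smul (c i) (f i)] with x hx
      simpa using hx
  filter_upwards [Lp.coeFn_finsetSum Finset.univ (fun i => c i • f i), h1] with x hx hx1
  rw [hx, Finset.sum_apply]
  exact Finset.sum_congr rfl fun i _ => hx1 i

theorem rightRegular_coeffLp (π : UnitaryIrrep G) (i j : Fin π.dim) (g : G) :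
    rightRegular μ g (π.coeffLp μ i j) = ∑ l, π.matrix g l j • π.coeffLp μ i l := by
  refine Lp.ext ((coeFn_rightRegular μ g _).trans ?_)
  refine EventuallyEq.trans ?_ (coeFn_sum_smul μ _ _).symm
  have h1 : ∀ᵐ x ∂μ, ∀ l, π.coeffLp μ i l x = π.matrix x i l :=
    ae_all_iff.2 fun l => π.coeFn_coeffLp μ i l
  filter_upwards [h1, (measurePreserving_mul_right_of_compactSpace μ g).quasiMeasurePreserving.ae
    (π.coeFn_coeffLp μ i j)] with x hx hx2
  rw [hx2, π.matrix_mul, Matrix.mul_apply]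
  exact Finset.sum_congr rfl fun l _ => by rw [hx l, mul_comm]

/-- A vector of `L²(G)` transforming under the right regular representation as a basis vector of
`π` is a combination of matrix coefficients of `π`. -/
theorem mem_span_coeffLp [SecondCountableTopology G] (π : UnitaryIrrep G)
    (b : Fin π.dim → Lp ℂ 2 μ)
    (hb : ∀ g j, rightRegular μ g (b j) = ∑ i, π.matrix g i j • b i) (j : Fin π.dim) :
    b j ∈ Submodule.span ℂ (Set.range fun l => π.coeffLp μ l j) := by
  have hmeas : ∀ i, Measurable (b i) := fun i => (Lp.stronglyMeasurable (b i)).measurable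
  have hπ : ∀ i l, Measurable fun g => π.matrix g i l := fun i l =>
    (π.continuous_matrix i l).measurable
  have h1 : ∀ᵐ g ∂μ, ∀ᵐ x ∂μ, b j (x * g) = ∑ i, π.matrix g i j * b i x := by
    refine Eventually.of_forall fun g => ?_
    have h2 := coeFn_rightRegular μ g (b j)
    rw [hb] at h2
    filter_upwards [h2, coeFn_sum_smul μ (fun i => π.matrix g i j) b] with x hx hx2
    rw [← hx, hx2]
  have hset : MeasurableSet {p : G × G | b j (p.2 * p.1) = ∑ i, π.matrix p.1 i j * b i p.2} :=
    measurableSet_eq_fun ((hmeas j).comp (measurable_snd.mul measurable_fst))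
      (Finset.measurable_sum _ fun i _ =>
        ((hπ i j).comp measurable_fst).mul ((hmeas i).comp measurable_snd))
  rw [Measure.ae_ae_comm hset] at h1
  obtain ⟨x, hx⟩ := h1.exists
  have h3 : b j = ∑ l, (∑ i, π.matrix x⁻¹ i l * b i x) • π.coeffLp μ l j := by
    refine Lp.ext (EventuallyEq.trans ?_ (coeFn_sum_smul μ _ _).symm)
    have h4 : ∀ᵐ y ∂μ, ∀ l, π.coeffLp μ l j y = π.matrix y l j :=
      ae_all_iff.2 fun l => π.coeFn_coeffLp μ l j
    filter_upwards [h4, (measurePreserving_mul_left μ x⁻¹).quasiMeasurePreserving.ae hx]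
      with y hy hy2
    rw [mul_inv_cancel_left] at hy2
    rw [hy2]
    simp only [hy, π.matrix_mul, Matrix.mul_apply, Finset.sum_mul]
    rw [Finset.sum_comm]
    exact Finset.sum_congr rfl fun l _ => Finset.sum_congr rfl fun i _ => by ring
  rw [h3]
  exact Submodule.sum_mem _ fun l _ => Submodule.smul_mem _ _ (Submodule.subset_span ⟨l, rfl⟩)

/-- **Peter–Weyl**: a vector of `L²(G)` that is orthogonal to all matrix coefficients vanishes. -/
theorem eq_zero_of_forall_inner_coeffLp [T2Space G] [SecondCountableTopology G]
    [IsProbabilityMeasure μ] (ψ : Lp ℂ 2 μ)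
    (hψ : ∀ (π : UnitaryIrrep G) i j, ⟪π.coeffLp μ i j, ψ⟫_ℂ = 0) : ψ = 0 := by
  by_contra hne
  have hinv : ∀ g (f f' : Lp ℂ 2 μ),
      ⟪f, rightRegular μ g f'⟫_ℂ = ⟪rightRegular μ g⁻¹ f, f'⟫_ℂ := by
    intro g f f'
    rw [← inner_rightRegular μ g (rightRegular μ g⁻¹ f) f', ← Module.End.mul_apply, ← map_mul]
    simp
  obtain ⟨W, hWfin, hW0, hWinv, hWorth⟩ := exists_finiteDimensional_invariant μ (rightRegular μ)
    (continuous_rightRegular μ) (inner_rightRegular μ) hne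
  obtain ⟨W₀, hle, h0, hinv₀, hirr⟩ := exists_irreducible_subspace (rightRegular μ) hW0 hWinv
  have : FiniteDimensional ℂ W₀ := Submodule.finiteDimensional_of_le hle
  let σ : Representation ℂ G W₀ :=
    { toFun := fun g => (rightRegular μ g).restrict (hinv₀ g)
      map_one' := by ext1 w; exact Subtype.ext (by simp)
      map_mul' := fun g h => by ext1 w; exact Subtype.ext (by simp) }
  have hσ : ∀ g w, ((σ g w : W₀) : Lp ℂ 2 μ) = rightRegular μ g w := fun g w => rfl
  have hσirr : IsIrreducibleUnitary σ := by
    refine ⟨fun w => (continuous_rightRegular μ (w : Lp ℂ 2 μ)).subtype_mk _,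
      fun g v w => inner_rightRegular μ g v w, (isIrreducible_iff σ).2
        ⟨Submodule.nontrivial_iff_ne_bot.2 h0, fun V hV => ?_⟩⟩
    have h1 := hirr (V.map W₀.subtype) (Submodule.map_subtype_le _ _) (by
      rintro g _ ⟨w, hw, rfl⟩
      exact ⟨σ g w, hV g w hw, rfl⟩)
    rcases h1 with h1 | h1
    · refine Or.inl (Submodule.map_injective_of_injective W₀.injective_subtype ?_)
      rw [h1, Submodule.map_bot]
    · refine Or.inr (Submodule.map_injective_of_injective W₀.injective_subtype ?_)
      rw [h1, Submodule.map_top, Submodule.range_subtype]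
  obtain ⟨π, e, he⟩ := exists_unitaryIrrep σ hσirr
  let v : Fin π.dim → W₀ := fun j => e.symm (EuclideanSpace.single j 1)
  have hv : ∀ g j, σ g (v j) = ∑ i, π.matrix g i j • v i := by
    intro g j
    refine e.injective ?_
    rw [← he, map_sum]
    ext i
    simp [v, UnitaryIrrep.matrix, Finset.sum_apply, Pi.single_apply]
  have hb : ∀ g j, rightRegular μ g (v j : Lp ℂ 2 μ) = ∑ i, π.matrix g i j • (v i : Lp ℂ 2 μ) := by
    intro g j
    rw [← hσ, hv]
    simp
  have horth : ∀ w ∈ W₀, ∀ i j, ⟪π.coeffLp μ i j, w⟫_ℂ = 0 := by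
    intro w hw i j
    refine hWorth _ (fun z => ?_) w (hle hw)
    rw [hinv, rightRegular_coeffLp, sum_inner]
    exact Finset.sum_eq_zero fun l _ => by rw [inner_smul_left, hψ, mul_zero]
  let j₀ : Fin π.dim := ⟨0, π.dim_pos⟩
  have hmem := mem_span_coeffLp μ π (fun j => (v j : Lp ℂ 2 μ)) hb j₀
  have h2 : ⟪(v j₀ : Lp ℂ 2 μ), (v j₀ : Lp ℂ 2 μ)⟫_ℂ = 0 := by
    have h3 : Submodule.span ℂ (Set.range fun l => π.coeffLp μ l j₀) ≤
        (ℂ ∙ (v j₀ : Lp ℂ 2 μ))ᗮ := by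
      rw [Submodule.span_le]
      rintro _ ⟨l, rfl⟩
      rw [SetLike.mem_coe, Submodule.mem_orthogonal_singleton_iff_inner_left]
      exact horth _ (v j₀).2 l j₀
    exact Submodule.mem_orthogonal_singleton_iff_inner_left.1 (h3 hmem)
  rw [inner_self_eq_zero] at h2
  have h4 : v j₀ = 0 := Subtype.ext h2
  have h5 : (EuclideanSpace.single j₀ (1 : ℂ)) = 0 := by
    rw [← e.apply_symm_apply (EuclideanSpace.single j₀ (1 : ℂ)), ← map_zero e]
    exact congrArg e h4
  simpa using congrArg (fun w : EuclideanSpace ℂ (Fin π.dim) => w j₀) h5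

end PeterWeyl

section Fourier

variable {G : Type*} [Group G] [TopologicalSpace G] [IsTopologicalGroup G] [CompactSpace G]
  [MeasurableSpace G] [BorelSpace G] (μ : Measure G) [μ.IsHaarMeasure]

omit [IsTopologicalGroup G] in
theorem inner_coeffLp (π π' : UnitaryIrrep G) (i j : Fin π.dim) (k l : Fin π'.dim) :
    ⟪π.coeffLp μ i j, π'.coeffLp μ k l⟫_ℂ = schurMatrix μ π π' i k j l := by
  refine (ContinuousMap.inner_toLp μ (π.coeff i j) (π'.coeff k l)).trans ?_
  simp only [schurMatrix, Matrix.of_apply]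
  exact integral_congr_ae (Eventually.of_forall fun z => mul_comm _ _)

omit [IsTopologicalGroup G] in
/-- Matrix coefficients of equivalent representations are combinations of each other. -/
theorem coeffLp_mem_span_of_equiv {π π' : UnitaryIrrep G} (h : π.toDual = π'.toDual)
    (i j : Fin π.dim) : π.coeffLp μ i j ∈
      Submodule.span ℂ (Set.range fun p : Fin π'.dim × Fin π'.dim => π'.coeffLp μ p.1 p.2) := by
  obtain ⟨φ⟩ := Quotient.exact h
  let e := φ.toLinearEquiv
  have he : ∀ g v, e (π.rep g v) = π'.rep g (e v) := fun g v =>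
    congrArg (fun f => f v) (φ.isIntertwining' g)
  let s : Fin π.dim → EuclideanSpace ℂ (Fin π.dim) := fun j => EuclideanSpace.single j 1
  let t : Fin π'.dim → EuclideanSpace ℂ (Fin π'.dim) := fun j => EuclideanSpace.single j 1
  have h1 : ∀ g, π.matrix g i j =
      ∑ k, ∑ l, (e (s j) l * e.symm (t k) i) * π'.matrix g k l := by
    intro g
    have h2 : π.rep g (s j) = e.symm (π'.rep g (e (s j))) := by
      rw [← he, e.symm_apply_apply]
    have h3 : π'.rep g (e (s j)) = ∑ k, (∑ l, π'.matrix g k l * e (s j) l) • t k := by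
      ext k
      rw [π'.rep_apply]
      simp [t, Pi.single_apply]
    change π.rep g (s j) i = _
    rw [h2, h3, map_sum]
    simp only [map_smul, WithLp.ofLp_sum, WithLp.ofLp_smul, Finset.sum_apply, Pi.smul_apply,
      smul_eq_mul, Finset.sum_mul]
    exact Finset.sum_congr rfl fun k _ => Finset.sum_congr rfl fun l _ => by ring
  have h4 : π.coeffLp μ i j = ∑ k, ∑ l, (e (s j) l * e.symm (t k) i) • π'.coeffLp μ k l := by
    have h5 : π.coeff i j = ∑ k, ∑ l, (e (s j) l * e.symm (t k) i) • π'.coeff k l := by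
      ext g
      rw [ContinuousMap.sum_apply]
      simp only [ContinuousMap.sum_apply]
      exact h1 g
    simp only [UnitaryIrrep.coeffLp, h5, map_sum, map_smul]
  rw [h4]
  exact Submodule.sum_mem _ fun k _ => Submodule.sum_mem _ fun l _ =>
    Submodule.smul_mem _ _ (Submodule.subset_span ⟨(k, l), rfl⟩)

/-- The `π`-component of the Fourier series of `f`. -/
noncomputable def fourierPart (π : UnitaryIrrep G) (f : G → ℂ) : C(G, ℂ) :=
  ∑ i, ∑ j, ((π.dim : ℂ) * ∫ z, star (π.matrix z i j) * f z ∂μ) • π.coeff i j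

/-- The Fourier series of a continuous function converges unconditionally in `L²(G)`. -/
theorem hasSum_fourierPart [T2Space G] [SecondCountableTopology G] [IsProbabilityMeasure μ]
    (r : UnitaryDual G → UnitaryIrrep G) (hr : ∀ c, (r c).toDual = c) (f : C(G, ℂ)) :
    HasSum (fun c => ContinuousMap.toLp 2 μ ℂ (fourierPart μ (r c) f))
      (ContinuousMap.toLp 2 μ ℂ f) := by
  classical
  let v : (Σ c : UnitaryDual G, Fin (r c).dim × Fin (r c).dim) → Lp ℂ 2 μ := fun p =>
    ((Real.sqrt (r p.1).dim : ℝ) : ℂ) • (r p.1).coeffLp μ p.2.1 p.2.2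
  have hd : ∀ c, ((Real.sqrt (r c).dim : ℝ) : ℂ) * ((Real.sqrt (r c).dim : ℝ) : ℂ) = (r c).dim := by
    intro c
    rw [← Complex.ofReal_mul, Real.mul_self_sqrt (Nat.cast_nonneg _)]
    simp
  have hv : Orthonormal ℂ v := by
    rw [orthonormal_iff_ite]
    rintro ⟨c, i, j⟩ ⟨c', k, l⟩
    simp only [v, inner_smul_left, inner_smul_right, inner_coeffLp, Complex.conj_ofReal]
    by_cases hc : c = c'
    · subst hc
      rw [schurMatrix_self, ← mul_assoc, hd]
      have h0 : ((r c).dim : ℂ) ≠ 0 := by exact_mod_cast (r c).dim_pos.ne'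
      by_cases hik : i = k <;> by_cases hjl : j = l <;>
        simp [hik, hjl, h0]
    · have h1 : (r c).toDual ≠ (r c').toDual := by rwa [hr, hr]
      rw [schurMatrix_eq_zero μ h1, if_neg (fun h => hc (congrArg Sigma.fst h))]
      simp
  have hspan : (Submodule.span ℂ (Set.range v))ᗮ = ⊥ := by
    refine (Submodule.eq_bot_iff _).2 fun ψ hψ => ?_
    refine eq_zero_of_forall_inner_coeffLp μ ψ fun π i j => ?_
    have h1 := coeffLp_mem_span_of_equiv μ (hr π.toDual).symm i j
    refine (Submodule.mem_orthogonal _ _).1 hψ _ ?_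
    refine Submodule.span_le.2 ?_ h1
    rintro _ ⟨⟨k, l⟩, rfl⟩
    have h0 : ((Real.sqrt (r π.toDual).dim : ℝ) : ℂ) ≠ 0 := by
      intro h0
      have := hd π.toDual
      rw [h0, zero_mul] at this
      exact (r π.toDual).dim_pos.ne' (by exact_mod_cast this.symm)
    rw [SetLike.mem_coe, ← Submodule.smul_mem_iff _ h0]
    exact Submodule.subset_span ⟨⟨π.toDual, k, l⟩, rfl⟩
  let B := HilbertBasis.mkOfOrthogonalEqBot hv hspan
  have hB : ∀ p, B p = v p := fun p => by simp [B]
  have h1 := (B.hasSum_repr (ContinuousMap.toLp 2 μ ℂ f)).sigma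
    (fun c => hasSum_fintype _)
  convert h1 using 1
  funext c
  rw [fourierPart, Fintype.sum_prod_type, map_sum]
  refine Finset.sum_congr rfl fun i _ => ?_
  rw [map_sum]
  refine Finset.sum_congr rfl fun j _ => ?_
  have h2 : ⟪(r c).coeffLp μ i j, ContinuousMap.toLp 2 μ ℂ f⟫_ℂ =
      ∫ z, star ((r c).matrix z i j) * f z ∂μ := by
    refine (ContinuousMap.inner_toLp μ ((r c).coeff i j) f).trans ?_
    exact integral_congr_ae (Eventually.of_forall fun z => mul_comm _ _)
  rw [B.repr_apply_apply, hB, map_smul]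
  simp only [v, inner_smul_left, Complex.conj_ofReal]
  rw [smul_smul, h2, mul_right_comm, hd]
  rfl

end Fourier

section SmoothFourier

variable {G : Type*} [Group G] [TopologicalSpace G] [CompactSpace G]
  [MeasurableSpace G] [BorelSpace G] (μ : Measure G) [μ.IsHaarMeasure]

omit [CompactSpace G] [BorelSpace G] [μ.IsHaarMeasure] in
theorem fourierPart_apply (π : UnitaryIrrep G) (f : G → ℂ) (y : G) : fourierPart μ π f y =
    ∑ i, ∑ j, ((π.dim : ℂ) * ∫ z, star (π.matrix z i j) * f z ∂μ) * π.matrix y i j := by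
  simp only [fourierPart, ContinuousMap.sum_apply]
  rfl

/-- The `π`-component of the Fourier series of `f` as a convolution with the character of `π`. -/
theorem fourierPart_eq_integral [IsTopologicalGroup G] (π : UnitaryIrrep G) {f : G → ℂ}
    (hf : Continuous f) (y : G) : fourierPart μ π f y =
      ∫ w, f (w * y) * ((π.dim : ℂ) * (π.matrix w⁻¹).trace) ∂μ := by
  have hint : ∀ i j, Integrable (fun z => star (π.matrix z i j) * f z) μ := fun i j =>
    integrable_of_continuous μ ((continuous_star.comp (π.continuous_matrix i j)).mul hf)
  have hμ := isMulRightInvariant_of_compactSpace μ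
  rw [fourierPart_apply, ← integral_mul_right_eq_self (μ := μ)
    (fun z => f (z * y) * ((π.dim : ℂ) * (π.matrix z⁻¹).trace)) y⁻¹]
  simp only [← integral_const_mul, ← integral_mul_const]
  have h1 : ∀ i j, Integrable
      (fun z => (π.dim : ℂ) * (star (π.matrix z i j) * f z) * π.matrix y i j) μ :=
    fun i j => ((hint i j).const_mul _).mul_const _
  simp only [← integral_finsetSum _ fun j _ => h1 _ j]
  rw [← integral_finsetSum _ fun i _ => integrable_finsetSum _ fun j _ => h1 i j]
  refine integral_congr_ae (Eventually.of_forall fun z => ?_)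
  simp only [inv_mul_cancel_right, mul_inv_rev, inv_inv, π.matrix_mul, π.matrix_inv, Matrix.trace,
    Matrix.diag, Matrix.mul_apply, Matrix.conjTranspose_apply, Finset.mul_sum]
  exact Finset.sum_congr rfl fun i _ => Finset.sum_congr rfl fun j _ => by ring

variable [T2Space G] {n : ℕ} [ChartedSpace (EuclideanSpace ℝ (Fin n)) G] [LieGroup (𝓡 n) ∞ G]

theorem contMDiff_fourierPart (π : UnitaryIrrep G) (f : G → ℂ) :
    ContMDiff (𝓡 n) 𝓘(ℝ, ℂ) ∞ (fourierPart μ π f) := by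
  have h : (fourierPart μ π f : G → ℂ) ∈ smoothFunctions n G ℂ := by
    have h1 : (fourierPart μ π f : G → ℂ) = ∑ i, ∑ j,
        ((π.dim : ℂ) * ∫ z, star (π.matrix z i j) * f z ∂μ) • fun y => π.matrix y i j := by
      funext y
      simp [fourierPart_apply]
    rw [h1]
    exact Submodule.sum_mem _ fun i _ => Submodule.sum_mem _ fun j _ =>
      Submodule.smul_mem _ _ (contMDiff_matrix μ π i j)
  exact h

omit [T2Space G] in
theorem iterLeftInvDeriv_fourierPart (π : UnitaryIrrep G) {f : G → ℂ}
    (hf : ContMDiff (𝓡 n) 𝓘(ℝ, ℂ) ∞ f) (L : List (GroupLieAlgebra (𝓡 n) G)) :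
    iterLeftInvDeriv n L (fourierPart μ π f) = fourierPart μ π (iterLeftInvDeriv n L f) := by
  have hG : IsTopologicalGroup G := topologicalGroup_of_lieGroup (𝓡 n) ∞
  have hF : ContMDiff ((𝓡 n).prod (𝓡 n)) 𝓘(ℝ, ℂ) ∞ (fun p : G × G => f (p.2 * p.1)) :=
    hf.comp (contMDiff_snd.mul contMDiff_fst)
  let w : C(G, ℂ) := ⟨fun w => (π.dim : ℂ) * (π.matrix w⁻¹).trace, by
    refine continuous_const.mul (continuous_finsetSum _ fun i _ => ?_)
    exact (π.continuous_matrix i i).comp continuous_inv⟩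
  let Λ : C(G, ℂ) →L[ℝ] ℂ := (weightedIntegral μ (ContinuousMap.id G) w).restrictScalars ℝ
  have h1 : (fourierPart μ π f : G → ℂ) = fun y => Λ (sliceMap hF y) := by
    funext y
    exact fourierPart_eq_integral μ π hf.continuous y
  rw [h1, iterLeftInvDeriv_clm_slice hF Λ L]
  funext y
  rw [fourierPart_eq_integral μ π (contMDiff_iterLeftInvDeriv hf L).continuous y]
  change ∫ z, iterLeftInvDeriv n L (fun x => f (z * x)) y * _ ∂μ = _
  simp only [iterLeftInvDeriv_mul_left hf]
  rfl

/-- The `π`-component of the Fourier series of a smooth function. -/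
noncomputable def smoothFourierPart (π : UnitaryIrrep G) (φ : smoothFunctions n G ℂ) :
    smoothFunctions n G ℂ :=
  ⟨fourierPart μ π φ, contMDiff_fourierPart μ π φ⟩

omit [Group G] [μ.IsHaarMeasure] [T2Space G] in
theorem integral_norm_le_norm_toLp [IsProbabilityMeasure μ] (f : C(G, ℂ)) :
    ∫ x, ‖f x‖ ∂μ ≤ ‖ContinuousMap.toLp 2 μ ℂ f‖ := by
  have h1 : ∫ x, ‖f x‖ ∂μ = (eLpNorm f 1 μ).toReal := by
    rw [integral_norm_eq_lintegral_enorm f.continuous.aestronglyMeasurable,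
      eLpNorm_one_eq_lintegral_enorm]
  rw [h1, Lp.norm_def, eLpNorm_congr_ae (ContinuousMap.coeFn_toLp (p := 2) (𝕜 := ℂ) μ f)]
  refine ENNReal.toReal_mono ?_ (eLpNorm_le_eLpNorm_of_exponent_le (by norm_num)
    f.continuous.aestronglyMeasurable)
  rw [← eLpNorm_congr_ae (ContinuousMap.coeFn_toLp (p := 2) (𝕜 := ℂ) μ f)]
  exact (Lp.memLp _).eLpNorm_ne_top

/-- The Fourier series of a smooth function converges unconditionally in the `C^∞` topology. -/
theorem tendsto_sum_smoothFourierPart [IsProbabilityMeasure μ]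
    (r : UnitaryDual G → UnitaryIrrep G) (hr : ∀ c, (r c).toDual = c)
    (φ : smoothFunctions n G ℂ) :
    Tendsto (fun s : Finset (UnitaryDual G) => ∑ c ∈ s, smoothFourierPart μ (r c) φ) atTop
      (@nhds _ (smoothTopology n (smoothFunctions n G ℂ)) φ) := by
  have hG : IsTopologicalGroup G := topologicalGroup_of_lieGroup (𝓡 n) ∞
  have hsec : SecondCountableTopology G :=
    ChartedSpace.secondCountable_of_sigmaCompact (EuclideanSpace ℝ (Fin n)) G
  obtain ⟨S, C, hC, hsob⟩ := exists_sobolev (n := n) μ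
  rw [tendsto_smoothTopology_iff]
  intro (L : List (EuclideanSpace ℝ (Fin n)))
  rw [Metric.tendstoUniformly_iff]
  intro ε hε
  let D : List (EuclideanSpace ℝ (Fin n)) → C(G, ℂ) := fun L' =>
    ⟨iterVecDeriv (L' ++ L) (φ : G → ℂ), (contMDiff_iterVecDeriv φ.2 _).continuous⟩
  have hsum : Tendsto (fun s : Finset (UnitaryDual G) => C * ∑ L' ∈ S,
      ‖(∑ c ∈ s, ContinuousMap.toLp 2 μ ℂ (fourierPart μ (r c) (D L'))) -
        ContinuousMap.toLp 2 μ ℂ (D L')‖) atTop (𝓝 0) := by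
    have h1 : ∀ L' ∈ S, Tendsto (fun s : Finset (UnitaryDual G) =>
        ‖(∑ c ∈ s, ContinuousMap.toLp 2 μ ℂ (fourierPart μ (r c) (D L'))) -
          ContinuousMap.toLp 2 μ ℂ (D L')‖) atTop (𝓝 0) := fun L' _ =>
      tendsto_iff_norm_sub_tendsto_zero.1 (hasSum_fourierPart μ r hr (D L'))
    simpa using (tendsto_finsetSum S h1).const_mul C
  filter_upwards [hsum.eventually (gt_mem_nhds hε)] with s hs x
  refine lt_of_le_of_lt ?_ hs
  let ψ : smoothFunctions n G ℂ := ∑ c ∈ s, smoothFourierPart μ (r c) φ - φ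
  have hψ : ContMDiff (𝓡 n) 𝓘(ℝ, ℂ) ∞ (iterVecDeriv L (ψ : G → ℂ)) :=
    contMDiff_iterVecDeriv ψ.2 L
  have h2 := hsob _ hψ x
  rw [dist_comm, dist_eq_norm]
  have h3 : iterVecDeriv L ((ψ : smoothFunctions n G ℂ) : G → ℂ) x =
      iterVecDeriv L ((∑ c ∈ s, smoothFourierPart μ (r c) φ : smoothFunctions n G ℂ) : G → ℂ)
        x - iterVecDeriv L (φ : G → ℂ) x :=
    congrFun (iterLeftInvDeriv_sub le_rfl L _ _) x
  refine (congrArg norm h3).ge.trans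
    (h2.trans (mul_le_mul_of_nonneg_left (Finset.sum_le_sum fun L' _ => ?_) hC))
  have h4 : ∀ y, iterVecDeriv L' (iterVecDeriv L (ψ : G → ℂ)) y =
      (∑ c ∈ s, fourierPart μ (r c) (D L') - D L') y := by
    intro y
    have h5 : iterVecDeriv L' (iterVecDeriv L (ψ : G → ℂ)) =
        iterLeftInvDerivₗ (n := n) (G := G) (V := ℂ) (L' ++ L) ψ :=
      (iterLeftInvDeriv_append (G := G) L' L _).symm
    rw [h5, map_sub, map_sum]
    have h6 : ∀ c, ((iterLeftInvDerivₗ (n := n) (G := G) (V := ℂ) (L' ++ L)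
        (smoothFourierPart μ (r c) φ) : smoothFunctions n G ℂ) : G → ℂ) =
        fourierPart μ (r c) (D L') := fun c =>
      iterLeftInvDeriv_fourierPart μ (r c) φ.2 (L' ++ L)
    simp only [Submodule.coe_sub, Submodule.coe_sum, h6, Pi.sub_apply, Finset.sum_apply,
      ContinuousMap.sub_apply, ContinuousMap.sum_apply]
    rfl
  simp only [h4]
  refine (integral_norm_le_norm_toLp μ _).trans_eq ?_
  rw [map_sub, map_sum]

theorem hasSum_apply_smoothFourierPart [IsProbabilityMeasure μ]
    (r : UnitaryDual G → UnitaryIrrep G) (hr : ∀ c, (r c).toDual = c)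
    {V : Type*} [NormedAddCommGroup V] [NormedSpace ℂ V] (T : smoothFunctions n G ℂ →ₗ[ℂ] V)
    (hT : Continuous[smoothTopology n (smoothFunctions n G ℂ), inferInstance] T)
    (φ : smoothFunctions n G ℂ) :
    HasSum (fun c => T (smoothFourierPart μ (r c) φ)) (T φ) := by
  let _ := smoothTopology n (smoothFunctions n G ℂ)
  have h := (hT.tendsto φ).comp (tendsto_sum_smoothFourierPart μ r hr φ)
  refine h.congr fun s => ?_
  simp

end SmoothFourier

section Uniqueness

variable {n : ℕ} {G : Type*} [Group G] [TopologicalSpace G] [CompactSpace G] [T2Space G]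
  [ChartedSpace (EuclideanSpace ℝ (Fin n)) G] [LieGroup (𝓡 n) ∞ G]
  [MeasurableSpace G] [BorelSpace G] (μ : Measure G) [μ.IsHaarMeasure]
  {E₀ : Type*} [NormedAddCommGroup E₀] [InnerProductSpace ℂ E₀]
  {F₀ : Type*} [NormedAddCommGroup F₀] [InnerProductSpace ℂ F₀]

/-- A matrix coefficient as a smooth function. -/
noncomputable def UnitaryIrrep.smoothCoeff (π : UnitaryIrrep G) (i j : Fin π.dim) :
    smoothFunctions n G ℂ :=
  ⟨fun y => π.matrix y i j, contMDiff_matrix μ π i j⟩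

theorem smoothFourierPart_eq (π : UnitaryIrrep G) (φ : smoothFunctions n G ℂ) :
    smoothFourierPart μ π φ = ∑ i, ∑ j,
      ((π.dim : ℂ) * ∫ z, star (π.matrix z i j) * (φ : G → ℂ) z ∂μ) •
        (π.smoothCoeff μ i j : smoothFunctions n G ℂ) := by
  refine Subtype.ext (funext fun y => ?_)
  simp only [Submodule.coe_sum, Submodule.coe_smul, Finset.sum_apply, Pi.smul_apply, smul_eq_mul]
  exact fourierPart_apply μ π φ y

theorem rightTranslate_smoothCoeff (π : UnitaryIrrep G) (i j : Fin π.dim) (h : G) :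
    rightTranslate h (π.smoothCoeff μ i j : smoothFunctions n G ℂ) =
      ∑ l, π.matrix h l j • π.smoothCoeff μ i l := by
  refine Subtype.ext (funext fun y => ?_)
  simp only [Submodule.coe_sum, Submodule.coe_smul, Finset.sum_apply, Pi.smul_apply, smul_eq_mul]
  change π.matrix (y * h) i j = _
  rw [π.matrix_mul, Matrix.mul_apply]
  exact Finset.sum_congr rfl fun l _ => mul_comm _ _

theorem HomDistribution.ext_of_smoothCoeff [IsProbabilityMeasure μ]
    {T T' : HomDistribution n G E₀ F₀}
    (h : ∀ (π : UnitaryIrrep G) i j,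
      T.toLinearMap (π.smoothCoeff μ i j) = T'.toLinearMap (π.smoothCoeff μ i j)) : T = T' := by
  refine HomDistribution.ext (LinearMap.ext fun φ => ?_)
  let r : UnitaryDual G → UnitaryIrrep G := Quotient.out
  have hr : ∀ c, (r c).toDual = c := Quotient.out_eq
  refine (hasSum_apply_smoothFourierPart μ r hr T.toLinearMap T.continuous φ).unique ?_
  convert hasSum_apply_smoothFourierPart μ r hr T'.toLinearMap T'.continuous φ using 1
  funext c
  simp only [smoothFourierPart_eq, map_sum, map_smul, h]

variable [FiniteDimensional ℂ E₀] {K : Subgroup G}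

omit [CompactSpace G] [T2Space G] [LieGroup (𝓡 n) ∞ G] [MeasurableSpace G] [BorelSpace G] in
/-- The pairing with `∑ₗ λ_{il} ⊗ vₗ`. -/
theorem HomDistribution.pair_eq_sum {ι : Type*} [Fintype ι] (T : HomDistribution n G E₀ F₀)
    (u : smoothFunctions n G E₀) (φ : ι → smoothFunctions n G ℂ) (v : ι → E₀)
    (hu : ∀ y, (u : G → E₀) y = ∑ l, (φ l : G → ℂ) y • v l) :
    T.pair u = ∑ l, T.toLinearMap (φ l) (v l) := by
  have h1 : ∀ b : E₀, component b u = ∑ l, ⟪b, v l⟫_ℂ • φ l := by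
    intro b
    refine Subtype.ext (funext fun y => ?_)
    simp only [Submodule.coe_sum, Submodule.coe_smul, Finset.sum_apply, Pi.smul_apply, smul_eq_mul]
    change ⟪b, (u : G → E₀) y⟫_ℂ = _
    rw [hu, inner_sum]
    exact Finset.sum_congr rfl fun l _ => by rw [inner_smul_right, mul_comm]
  simp only [HomDistribution.pair, h1, map_sum, map_smul, sum_apply, smul_apply]
  rw [Finset.sum_comm]
  refine Finset.sum_congr rfl fun l _ => ?_
  conv_rhs => rw [← (stdOrthonormalBasis ℂ E₀).sum_repr' (v l), map_sum]
  simp only [map_smul]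

/-- The values of a Schwartz kernel on matrix coefficients are determined by the operator. -/
theorem IsSchwartzKernel.apply_smoothCoeff [FiniteDimensional ℂ F₀] [CompactSpace K]
    [MeasurableSpace K] [BorelSpace K]
    (ν : Measure K) [IsProbabilityMeasure ν] [ν.IsMulLeftInvariant]
    {τE : Representation ℂ K E₀} (hτ : ∀ v, Continuous fun h => τE h v)
    {τF : Representation ℂ K F₀} {A : smoothSections n τE →ₗ[ℂ] smoothSections n τF}
    {k : G → HomDistribution n G E₀ F₀} (hk : IsSchwartzKernel A k) (π : UnitaryIrrep G)
    (i j : Fin π.dim) (v : E₀) (x : G) :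
    (k x).toLinearMap (π.smoothCoeff μ i j) v =
      (A (averageSection ν hτ (π.smoothCoeff μ i j) v) : G → F₀) x := by
  have hint : ∀ l, Integrable (fun h : K => π.matrix (h : G) l j • τE h v) ν := fun l =>
    integrable_of_continuous ν
      (((π.continuous_matrix l j).comp continuous_subtype_val).smul (hτ v))
  rw [hk.represents, (k x).pair_eq_sum _ (fun l => π.smoothCoeff μ i l)
    (fun l => ∫ h : K, π.matrix (h : G) l j • τE h v ∂ν)]
  · have hcomm : ∀ l, (k x).toLinearMap (π.smoothCoeff μ i l)
        (∫ h : K, π.matrix (h : G) l j • τE h v ∂ν) = ∫ h : K,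
          (k x).toLinearMap (π.smoothCoeff μ i l) (π.matrix (h : G) l j • τE h v) ∂ν := fun l =>
      (ContinuousLinearMap.integral_comp_comm _ (hint l)).symm
    rw [Finset.sum_congr rfl fun l _ => hcomm l, ← integral_finsetSum _ fun l _ =>
      ((k x).toLinearMap (π.smoothCoeff μ i l)).integrable_comp (hint l)]
    have h1 : ∀ h : K, ∑ l, (k x).toLinearMap (π.smoothCoeff μ i l)
        (π.matrix (h : G) l j • τE h v) = (k x).toLinearMap (π.smoothCoeff μ i j) v := by
      intro h
      have h2 := hk.equivariant x h (rightTranslate (h : G) (π.smoothCoeff μ i j)) v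
      have h3 : rightTranslate (h : G)⁻¹ (rightTranslate (h : G)
          (π.smoothCoeff μ i j : smoothFunctions n G ℂ)) = π.smoothCoeff μ i j := by
        refine Subtype.ext (funext fun y => ?_)
        change π.matrix (y * (h : G)⁻¹ * h) i j = π.matrix y i j
        rw [inv_mul_cancel_right]
      rw [h3, rightTranslate_smoothCoeff] at h2
      rw [h2]
      simp only [map_sum, map_smul, sum_apply, smul_apply]
    simp only [h1]
    simp
  · intro g
    have hint' : ∀ l, Integrable
        (fun h : K => π.matrix g i l • π.matrix (h : G) l j • τE h v) ν := fun l => (hint l).smul _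
    change ∫ h : K, π.matrix (g * h) i j • τE h v ∂ν =
      ∑ l, π.matrix g i l • ∫ h : K, π.matrix (h : G) l j • τE h v ∂ν
    simp only [← integral_smul]
    rw [← integral_finsetSum _ fun l _ => hint' l]
    refine integral_congr_ae (Eventually.of_forall fun h => ?_)
    simp only [smul_smul]
    rw [← Finset.sum_smul, π.matrix_mul, Matrix.mul_apply]

theorem IsSchwartzKernel.unique [FiniteDimensional ℂ F₀] [IsProbabilityMeasure μ]
    (hK : IsClosed (K : Set G)) {τE : Representation ℂ K E₀} (hτ : ∀ v, Continuous fun h => τE h v)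
    {τF : Representation ℂ K F₀} {A : smoothSections n τE →ₗ[ℂ] smoothSections n τF}
    {k k' : G → HomDistribution n G E₀ F₀} (hk : IsSchwartzKernel A k)
    (hk' : IsSchwartzKernel A k') : k = k' := by
  have : IsTopologicalGroup G := topologicalGroup_of_lieGroup (𝓡 n) ∞
  have : CompactSpace K := isCompact_iff_compactSpace.1 hK.isCompact
  let ν : Measure K := Measure.haarMeasure ⊤
  have : IsProbabilityMeasure ν := ⟨Measure.haarMeasure_self (K₀ := ⊤)⟩
  funext x
  refine HomDistribution.ext_of_smoothCoeff μ fun π i j => ?_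
  ext v
  rw [hk.apply_smoothCoeff μ ν hτ, hk'.apply_smoothCoeff μ ν hτ]

end Uniqueness

section SymbolFormula

variable {n : ℕ} {G : Type*} [Group G] [TopologicalSpace G] [CompactSpace G] [T2Space G]
  [ChartedSpace (EuclideanSpace ℝ (Fin n)) G] [LieGroup (𝓡 n) ∞ G]
  [MeasurableSpace G] [BorelSpace G] (μ : Measure G) [μ.IsHaarMeasure]
  {E₀ : Type*} [NormedAddCommGroup E₀] [InnerProductSpace ℂ E₀]
  {F₀ : Type*} [NormedAddCommGroup F₀] [InnerProductSpace ℂ F₀]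

theorem symbol_apply (k : G → HomDistribution n G E₀ F₀) (π : UnitaryIrrep G) (hπ : π.IsSmooth n)
    (x : G) (l m : Fin π.dim) : symbol k π hπ x l m =
      ∑ p, π.matrix x⁻¹ l p • (k x).toLinearMap (π.smoothCoeff μ p m) := by
  have h1 : invSubst x (⟨fun z => (π.matrix z)ᴴ l m, hπ l m⟩ : smoothFunctions n G ℂ) =
      ∑ p, π.matrix x⁻¹ l p • π.smoothCoeff μ p m := by
    refine Subtype.ext (funext fun y => ?_)
    simp only [Submodule.coe_sum, Submodule.coe_smul, Finset.sum_apply, Pi.smul_apply,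
      smul_eq_mul]
    change (π.matrix (y⁻¹ * x))ᴴ l m = _
    rw [← π.matrix_inv, mul_inv_rev, inv_inv, π.matrix_mul, Matrix.mul_apply]
    rfl
  change (k x).toLinearMap _ = _
  rw [h1, map_sum]
  simp only [map_smul]

theorem sum_matrix_smul_symbol (k : G → HomDistribution n G E₀ F₀) (π : UnitaryIrrep G)
    (hπ : π.IsSmooth n) (x : G) (i m : Fin π.dim) :
    ∑ l, π.matrix x i l • symbol k π hπ x l m = (k x).toLinearMap (π.smoothCoeff μ i m) := by
  simp only [symbol_apply μ, Finset.smul_sum, smul_smul]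
  rw [Finset.sum_comm]
  simp only [← Finset.sum_smul, ← Matrix.mul_apply, ← π.matrix_mul, mul_inv_cancel, π.matrix_one,
    Matrix.one_apply, ite_smul, one_smul, zero_smul, Finset.sum_ite_eq, Finset.mem_univ, if_true]

theorem smul_trace_symbol [FiniteDimensional ℂ E₀] (k : G → HomDistribution n G E₀ F₀)
    (π : UnitaryIrrep G) (hπ : π.IsSmooth n) (u : smoothFunctions n G E₀) (x : G) :
    (π.dim : ℂ) • Matrix.trace (scalarMul (π.matrix x)
        (applySymbol (symbol k π hπ x) (fourierCoeff μ (u : G → E₀) π))) =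
      ∑ a, (k x).toLinearMap (smoothFourierPart μ π (component (stdOrthonormalBasis ℂ E₀ a) u))
        (stdOrthonormalBasis ℂ E₀ a) := by
  have hint : ∀ i m, Integrable (fun y => star (π.matrix y i m) • (u : G → E₀) y) μ := fun i m =>
    integrable_of_continuous μ
      ((continuous_star.comp (π.continuous_matrix i m)).smul u.2.continuous)
  have hL : Matrix.trace (scalarMul (π.matrix x)
      (applySymbol (symbol k π hπ x) (fourierCoeff μ (u : G → E₀) π))) =
      ∑ i, ∑ m, (k x).toLinearMap (π.smoothCoeff μ i m)
        (∫ y, star (π.matrix y i m) • (u : G → E₀) y ∂μ) := by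
    simp only [Matrix.trace, Matrix.diag, scalarMul, applySymbol, fourierCoeff, Matrix.of_apply,
      Matrix.conjTranspose_apply, Finset.smul_sum]
    refine Finset.sum_congr rfl fun i _ => ?_
    rw [Finset.sum_comm]
    refine Finset.sum_congr rfl fun m _ => ?_
    rw [← sum_matrix_smul_symbol μ k π hπ x i m]
    simp only [sum_apply, smul_apply]
  have hR : ∀ (b : E₀) (i m : Fin π.dim),
      ∫ z, star (π.matrix z i m) * (component b u : G → ℂ) z ∂μ =
        ⟪b, ∫ y, star (π.matrix y i m) • (u : G → E₀) y ∂μ⟫_ℂ := by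
    intro b i m
    rw [← integral_inner (hint i m)]
    simp only [inner_smul_right]
    rfl
  rw [hL]
  simp only [smoothFourierPart_eq, map_sum, map_smul, sum_apply, smul_apply, hR]
  rw [Finset.smul_sum, Finset.sum_comm]
  refine Finset.sum_congr rfl fun i _ => ?_
  rw [Finset.smul_sum, Finset.sum_comm]
  refine Finset.sum_congr rfl fun m _ => ?_
  conv_lhs => rw [← (stdOrthonormalBasis ℂ E₀).sum_repr'
    (∫ y, star (π.matrix y i m) • (u : G → E₀) y ∂μ)]
  simp only [map_sum, map_smul, Finset.smul_sum, mul_smul]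

end SymbolFormula

end HomogeneousBundle

theorem mainTheorem6 {n : ℕ} {G : Type*} [Group G] [TopologicalSpace G] [CompactSpace G]
    [T2Space G] [ChartedSpace (EuclideanSpace ℝ (Fin n)) G] [LieGroup (𝓡 n) ∞ G]
    [MeasurableSpace G] [BorelSpace G]
    (μ : Measure G) [μ.IsHaarMeasure] [IsProbabilityMeasure μ]
    (K : Subgroup G) (hK : IsClosed (K : Set G))
    {E₀ : Type*} [NormedAddCommGroup E₀] [InnerProductSpace ℂ E₀] [FiniteDimensional ℂ E₀]
    {F₀ : Type*} [NormedAddCommGroup F₀] [InnerProductSpace ℂ F₀] [FiniteDimensional ℂ F₀]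
    (τE : Representation ℂ K E₀) (hE : HomogeneousBundle.IsIrreducibleUnitary τE)
    (τF : Representation ℂ K F₀) (hF : HomogeneousBundle.IsIrreducibleUnitary τF)
    (A : HomogeneousBundle.smoothSections n τE →ₗ[ℂ] HomogeneousBundle.smoothSections n τF)
    (hA : HomogeneousBundle.IsHomogeneousOperator A) :
    ∃ hsmooth : ∀ π : HomogeneousBundle.UnitaryIrrep G, π.IsSmooth n,
      (∃! k : G → HomogeneousBundle.HomDistribution n G E₀ F₀,
        HomogeneousBundle.IsSchwartzKernel A k) ∧
      ∀ k : G → HomogeneousBundle.HomDistribution n G E₀ F₀,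
        HomogeneousBundle.IsSchwartzKernel A k →
        ∀ r : HomogeneousBundle.UnitaryDual G → HomogeneousBundle.UnitaryIrrep G,
          (∀ c, (r c).toDual = c) →
          ∀ (u : HomogeneousBundle.smoothSections n τE) (x : G),
            HasSum
              (fun c => ((r c).dim : ℂ) • Matrix.trace
                (HomogeneousBundle.scalarMul ((r c).matrix x)
                  (HomogeneousBundle.applySymbol
                    (HomogeneousBundle.symbol k (r c) (hsmooth (r c)) x)
                    (HomogeneousBundle.fourierCoeff μ (u : G → E₀) (r c)))))
              ((A u : G → F₀) x) := by
  refine ⟨fun π => π.isSmooth μ, ?_, ?_⟩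
  · obtain ⟨k, hk⟩ := HomogeneousBundle.exists_isSchwartzKernel hK hE.continuous A hA.continuous
    exact ⟨k, hk, fun k' hk' => hk'.unique μ hK hE.continuous hk⟩
  · intro k hk r hr u x
    have h1 := hasSum_sum (s := Finset.univ) fun a _ =>
      (HomogeneousBundle.hasSum_apply_smoothFourierPart μ r hr (k x).toLinearMap (k x).continuous
        (HomogeneousBundle.component (stdOrthonormalBasis ℂ E₀ a)
          (HomogeneousBundle.toSmooth u))).mapL
        (ContinuousLinearMap.apply ℂ F₀ (stdOrthonormalBasis ℂ E₀ a))
    rw [hk.represents]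
    exact (funext fun c => HomogeneousBundle.smul_trace_symbol μ k (r c) _
      (HomogeneousBundle.toSmooth u) x) ▸ h1
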